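/- **Setting (asymmetric 2-photon protocol).** Alice prepares the two-mode squeezed vacuum $\sum_{m\ge 0}\frac{\tanh^m g}{\cosh g}|m,m\rangle_{a_1a_2}$ with real gain $g$. Bob sends one mode of a two-mode squeezed vacuum of gain $g_b$, heralded by a click (operator $\mathbb 1-(1-\eta_s)^{\hat n}$, $0<\eta_s\le 1$) of an on/off detector on the other mode, together with the vacuum, through a beam splitter of transmissivity $t_s\in[0,1]$, reflectivity $r_s=1-t_s$ and phase $\phi_s$. This gives a state of $(b_1,b_2)$, whose ideal version is $|\psi_b\rangle=\sqrt{t_s}\,|0,1\rangle_{b_1b_2}+e^{i\phi_s}\sqrt{r_s}\,|1,0\rangle_{b_1b_2}$. The modes $a_2,b_2$ each suffer photon loss $r_t\in[0,1)$ (beam splitter of reflectivity $r_t$ with a vacuum ancilla that is traced out). Charlie, with a symmetric beam splitter of phase $\phi_c$, detects one photon without learning its frequency. If the photons of $a_2$ and $b_2$ have normalised spectral amplitudes $f,h\in L^2(\mathbb R)$, his operator is $\int d\omega\,|\chi_\omega\rangle\langle\chi_\omega|$ with $\langle\chi_\omega|=\tfrac1{\sqrt2}\big(h(\omega)\langle 0,1|+e^{-i\phi_c}f(\omega)\langle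 1,0|\big)_{a_2b_2}$; put $v=\int f^*(\omega)h(\omega)\,d\omega$ (so $v=1$ if $f=h$). Let $\rho$ be the resulting normalised state of $(a_1,b_1)$, and $\rho_a,\rho_b$ its reduced states. For $\alpha,\beta\in\mathbb C$ and detector efficiency $\eta_d\in[0,1]$ let $\mathcal M_0(\delta)=D(\delta)(1-\eta_d)^{a^\dagger a}D(\delta)^\dagger$ with $D(\delta)=e^{\delta a^\dagger-\delta^*a}$, and $$P(0|\alpha)=\mathrm{Tr}[\rho_a\mathcal M_0(\alpha)],\quad P(0|\beta)=\mathrm{Tr}[\rho_b\mathcal M_0(\beta)],\quad P(00|\alpha,\beta)=\mathrm{Tr}[\rho\,\mathcal M_0(\alpha)\otimes\mathcal M_0(\beta)].$$ Assume $g\ne0$ or $t_s\neq 0$, and put $C=r_t\tanh^2 g$ and $D=1-C(1-\eta_d)$. **Statement.** When Bob's state is the ideal $|\psi_b\rangle\langle\psi_b|$, and likewise in the limit $g_b\to0$, $g_b\neq 0$, for the heralded source, these three probabilities are $$\tilde P_{2ph}(0|\alpha)=\exp\!\Big(-\tfrac{(1-C)\eta_d|\alpha|^2}{D}\Big)\Big(\frac{1-C}{D}\Big)^2\,\frac{t_s\big(1+\frac{C\eta_d^2|\alpha|^2}{D}\big)+r_s\tanh^2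 g\,\big(1-\eta_d+\frac{\eta_d^2|\alpha|^2}{D}\big)}{t_s+r_s\tanh^2 g},$$ $$\tilde P_{2ph}(0|\beta)=e^{-\eta_d|\beta|^2}\,\frac{t_s+r_s\tanh^2 g\,(1-\eta_d+\eta_d^2|\beta|^2)}{t_s+r_s\tanh^2 g},$$ $$\tilde P_{2ph}(00|\alpha,\beta)=\frac{\exp\!\big(-\frac{(1-C)\eta_d|\alpha|^2}{D}-\eta_d|\beta|^2\big)(1-C)^2}{(t_s+r_s\tanh^2 g)\,D^2}\Big[t_s\Big(1+\tfrac{C\eta_d^2|\alpha|^2}{D}\Big)+r_s\tanh^2 g\,\Big(1-\eta_d+\tfrac{\eta_d^2|\alpha|^2}{D}\Big)(1-\eta_d+\eta_d^2|\beta|^2)+2\eta_d^2\tanh g\,\sqrt{t_sr_s}\;J\Big],$$ where $J=\mathrm{Re}\big(e^{i(\phi_c-\phi_s)}v\,\alpha\beta\big)$. In particular, if $e^{i(\phi_c-\phi_s)}=-i$, then $J=\mathrm{Im}(v\,\alpha\beta)$, and for perfect visibility ($f=h$) $J=\mathrm{Im}(\alpha\beta)$. -/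

import Mathlib

open scoped Matrix Kronecker Topology ComplexConjugate
open MeasureTheory Filter

namespace TwoPhoton

noncomputable section

/-! ### Operators on Fock space

An operator on the Fock space of one mode (basis `ℕ`) or of several modes (basis a product
of copies of `ℕ`) is given by its matrix in the photon-number basis. -/

/-- Product of two operators. -/
def opMul {ι κ μ : Type*} (A : Matrix ι κ ℂ) (B : Matrix κ μ ℂ) : Matrix ι μ ℂ :=
  fun i j => ∑' k, A i k * B k j

/-- Powers of an operator. -/
def opPow {ι : Type*} [DecidableEq ι] (A : Matrix ι ι ℂ) : ℕ → Matrix ι ι ℂ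
  | 0 => 1
  | k + 1 => opMul A (opPow A k)

/-- Matrix elements of the exponential `exp A = ∑ₖ Aᵏ / k!`, the series being evaluated on the
number states. -/
def opExp {ι : Type*} [DecidableEq ι] (A : Matrix ι ι ℂ) : Matrix ι ι ℂ :=
  fun i j => ∑' k : ℕ, ((k.factorial : ℂ))⁻¹ * opPow A k i j

/-- Trace. -/
def opTrace {ι : Type*} (A : Matrix ι ι ℂ) : ℂ := ∑' i, A i i

/-- Partial trace over the second factor. -/
def ptraceSnd {ι κ : Type*} (A : Matrix (ι × κ) (ι × κ) ℂ) : Matrix ι ι ℂ :=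
  fun i j => ∑' k, A (i, k) (j, k)

/-- Partial trace over the first factor. -/
def ptraceFst {ι κ : Type*} (A : Matrix (ι × κ) (ι × κ) ℂ) : Matrix κ κ ℂ :=
  fun i j => ∑' k, A (k, i) (k, j)

/-- The operator `|ψ⟩⟨ψ|`. -/
def ketbra {ι : Type*} (ψ : ι → ℂ) : Matrix ι ι ℂ := fun i j => ψ i * conj (ψ j)

/-- Division of a positive operator by its trace. -/
def normalize {ι : Type*} (A : Matrix ι ι ℂ) : Matrix ι ι ℂ := (opTrace A)⁻¹ • A

/-- The vacuum vector of one mode. -/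
def vac : ℕ → ℂ := fun n => if n = 0 then 1 else 0

/-- Creation operator: `a† |m⟩ = √(m+1) |m+1⟩`. -/
def create : Matrix ℕ ℕ ℂ := fun n m => if n = m + 1 then (Real.sqrt n : ℂ) else 0

/-- Annihilation operator, the adjoint of the creation operator. -/
def annih : Matrix ℕ ℕ ℂ := createᴴ

/-- Displacement operator `D(δ) = exp (δ a† - δ* a)`. -/
def displacement (δ : ℂ) : Matrix ℕ ℕ ℂ := opExp (δ • create - conj δ • annih)

/-- No-click operator `(1-η)^{a† a}` of an on/off detector of efficiency `η`. -/
def noClick (η : ℝ) : Matrix ℕ ℕ ℂ := Matrix.diagonal fun m => (1 - (η : ℂ)) ^ m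

/-- Click operator of an on/off detector of efficiency `η`. -/
def click (η : ℝ) : Matrix ℕ ℕ ℂ := 1 - noClick η

/-- The local measurement operator `M₀ = D(δ) (1-η)^{a† a} D(δ)†`. -/
def localNoClick (η : ℝ) (δ : ℂ) : Matrix ℕ ℕ ℂ :=
  opMul (opMul (displacement δ) (noClick η)) (displacement δ)ᴴ

/-- The unitary of a beam splitter of transmissivity `t` and reflectivity `1 - t` on two modes
`x, y`. It maps the vacuum to itself and acts on creation operators by
`x† ↦ √t x† - e^{-iφ} √(1-t) y†` and `y† ↦ e^{iφ} √(1-t) x† + √t y†`.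
The matrix element `⟨p,q| U |m,n⟩` is `√(p! q!) / √(m! n!)` times the coefficient of
`x†^p y†^q` in the image of `x†^m y†^n`; that image is homogeneous of degree `m + n`,
so `y†` may be set to `1` when the coefficient is read off. -/
def beamSplitter (t φ : ℝ) : Matrix (ℕ × ℕ) (ℕ × ℕ) ℂ := fun o i =>
  if o.1 + o.2 = i.1 + i.2 then
    ((Real.sqrt (o.1.factorial * o.2.factorial) /
        Real.sqrt (i.1.factorial * i.2.factorial) : ℝ) : ℂ) *
      Polynomial.coeff
        ((Polynomial.C (Real.sqrt t : ℂ) * Polynomial.X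
            - Polynomial.C (Complex.exp (-(Complex.I * φ)) * Real.sqrt (1 - t))) ^ i.1 *
          (Polynomial.C (Complex.exp (Complex.I * φ) * Real.sqrt (1 - t)) * Polynomial.X
            + Polynomial.C (Real.sqrt t : ℂ)) ^ i.2) o.1
  else 0

/-- A lossy line of loss `r` on the last mode `x` of an operator `σ`: the mode `x` meets an
ancilla in the vacuum on a beam splitter of reflectivity `r`, and the ancilla is traced out,
`Tr_anc [U (σ ⊗ |0⟩⟨0|) U†]`. -/
def loss {ι : Type*} (r : ℝ) (σ : Matrix (ι × ℕ) (ι × ℕ) ℂ) : Matrix (ι × ℕ) (ι × ℕ) ℂ :=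
  fun i j => ∑' p : ℕ, ∑' m : ℕ, ∑' m' : ℕ,
    beamSplitter (1 - r) 0 (i.2, p) (m, 0) * σ (i.1, m) (j.1, m') *
      conj (beamSplitter (1 - r) 0 (j.2, p) (m', 0))

/-! ### Sources -/

/-- Two-mode squeezed vacuum `∑ₙ tanhⁿ g / cosh g |n,n⟩` of parametric gain `g`. -/
def tmsv (g : ℝ) : ℕ × ℕ → ℂ :=
  fun i => if i.1 = i.2 then ((Real.tanh g ^ i.1 / Real.cosh g : ℝ) : ℂ) else 0

/-- Bob's heralded source: one mode of a two-mode squeezed vacuum of gain `gb`, conditioned on a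
click of an on/off detector of efficiency `ηs` on the other mode. -/
def heraldedSource (gb ηs : ℝ) : Matrix ℕ ℕ ℂ :=
  normalize (ptraceFst (opMul (click ηs ⊗ₖ (1 : Matrix ℕ ℕ ℂ)) (ketbra (tmsv gb))))

/-- Bob's path-entangled state of `(b₁, b₂)`: the heralded source enters through `b₂`, the vacuum
through `b₁`, a beam splitter of transmissivity `ts`. -/
def bobState (gb ηs ts φs : ℝ) : Matrix (ℕ × ℕ) (ℕ × ℕ) ℂ :=
  opMul (opMul (beamSplitter ts φs) (ketbra vac ⊗ₖ heraldedSource gb ηs)) (beamSplitter ts φs)ᴴ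

/-- The ideal single-photon path-entangled vector `√ts |0,1⟩ + e^{iφs} √(1-ts) |1,0⟩` of
`(b₁, b₂)`. -/
def sppe (ts φs : ℝ) : ℕ × ℕ → ℂ
  | (0, 1) => (Real.sqrt ts : ℂ)
  | (1, 0) => Complex.exp (Complex.I * φs) * Real.sqrt (1 - ts)
  | _ => 0

/-! ### Heralding at the central station -/

/-- The amplitudes of a single-photon detection at frequency `ω` behind Charlie's beam splitter of
transmissivity `tc`, in the number basis of `(a₂, b₂)`, when the photons of `a₂` have spectral
amplitude `f` and those of `b₂` spectral amplitude `h`: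
`√tc h(ω) ⟨0,1| + e^{-iφc} √(1-tc) f(ω) ⟨1,0|`. -/
def charlieBra (tc φc : ℝ) (f h : ℝ → ℂ) (ω : ℝ) : ℕ × ℕ → ℂ
  | (0, 1) => Real.sqrt tc * h ω
  | (1, 0) => Complex.exp (-(Complex.I * φc)) * Real.sqrt (1 - tc) * f ω
  | _ => 0

/-- Charlie's measurement operator for one photon detected without frequency information:
the integral over `ω` of `|χ_ω⟩⟨χ_ω|`, where `⟨χ_ω|` is `charlieBra`. -/
def charlie (tc φc : ℝ) (f h : ℝ → ℂ) : Matrix (ℕ × ℕ) (ℕ × ℕ) ℂ :=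
  fun l k => ∫ ω : ℝ, conj (charlieBra tc φc f h ω l) * charlieBra tc φc f h ω k

/-- `Tr_{a₂ b₂} [Π (σA ⊗ σB)]` for states `σA` of `(a₁, a₂)`, `σB` of `(b₁, b₂)` and an
operator `Π` on `(a₂, b₂)`: the unnormalised state of `(a₁, b₁)` after the outcome `Π`. -/
def condState (Pi : Matrix (ℕ × ℕ) (ℕ × ℕ) ℂ) (σA σB : Matrix (ℕ × ℕ) (ℕ × ℕ) ℂ) :
    Matrix (ℕ × ℕ) (ℕ × ℕ) ℂ :=
  fun i j => ∑' k : ℕ × ℕ, ∑' l : ℕ × ℕ,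
    Pi l k * (σA (i.1, k.1) (j.1, l.1) * σB (i.2, k.2) (j.2, l.2))

/-- The state of `(a₁, b₁)` heralded by the two-photon protocol when Alice has a two-mode squeezed
vacuum of gain `g`, Bob the state `ρB` of `(b₁, b₂)`, both idler lines have loss `rt`, and
Charlie's beam splitter is symmetric with phase `φc`. -/
def rhoOut (g rt φc : ℝ) (f h : ℝ → ℂ) (ρB : Matrix (ℕ × ℕ) (ℕ × ℕ) ℂ) :
    Matrix (ℕ × ℕ) (ℕ × ℕ) ℂ :=
  normalize (condState (charlie (1 / 2) φc f h) (loss rt (ketbra (tmsv g))) (loss rt ρB))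

/-! ### No-click probabilities of a state `ρ` of `(a₁, b₁)` -/

/-- Alice's marginal `Tr [ρ_a M₀(α)]`. -/
def probA (η : ℝ) (α : ℂ) (ρ : Matrix (ℕ × ℕ) (ℕ × ℕ) ℂ) : ℂ :=
  opTrace (opMul (ptraceSnd ρ) (localNoClick η α))

/-- Bob's marginal `Tr [ρ_b M₀(β)]`. -/
def probB (η : ℝ) (β : ℂ) (ρ : Matrix (ℕ × ℕ) (ℕ × ℕ) ℂ) : ℂ :=
  opTrace (opMul (ptraceFst ρ) (localNoClick η β))

/-- The joint probability `Tr [ρ (M₀(α) ⊗ M₀(β))]`. -/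
def probAB (η : ℝ) (α β : ℂ) (ρ : Matrix (ℕ × ℕ) (ℕ × ℕ) ℂ) : ℂ :=
  opTrace (opMul ρ (localNoClick η α ⊗ₖ localNoClick η β))

end

end TwoPhoton

namespace TwoPhoton

/-! ### Matrix elements of the displacement operator -/

/-! Charlie's operator is supported on the vectors `|0,1⟩` and `|1,0⟩` of `(a₂, b₂)`. The
unnormalised heralded state is therefore a sum of four product operators (`condState_charlie`), and
each probability is a quotient of two sums of four products of one-mode traces.

On Alice's side the squeezed vacuum is perfectly correlated: if `k` photons arrive and `p` are lost,
`a₁` holds `k + p`. Her traces become power series in `C = r tanh² g` whose coefficients are matrix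
elements of `M₀` on or next to the diagonal. They are summed through the relation `(a - δ) M₀ = (1 -
η) M₀ (a - δ)` (`localNoClick_row`), which yields linear equations between generating functions and
a first-order differential equation for the diagonal one, solved in `diagGen_eq`. The relation
itself comes from the commutation of `a` and `a†` with powers of the unbounded generator `δ a† - δ*
a`, transported through the exponential series entry by entry. Its case `η = 0` is the unitarity
relation `D D† = 1`, which bounds all matrix elements of `M₀` by 1.

On Bob's side a single photon leaves finitely many terms, so `heraldedTrace_onePhoton` evaluates
everything. For the heralded source, normalisation makes scalar factors irrelevant (`rhoOut_smul`).
In units of the one-photon weight its number distribution tends to a single photon under a geometric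
bound, and dominated convergence applies (`tendsto_pairing_bob`). -/

/-- The complex number `√n`. -/
noncomputable def sqrtNat (n : ℕ) : ℂ := ((Real.sqrt n : ℝ) : ℂ)

@[simp] lemma sqrtNat_zero : sqrtNat 0 = 0 := by simp [sqrtNat]

@[simp] lemma sqrtNat_one : sqrtNat 1 = 1 := by simp [sqrtNat]

@[simp] lemma conj_sqrtNat (n : ℕ) : conj (sqrtNat n) = sqrtNat n := Complex.conj_ofReal _

lemma sqrtNat_mul_self (n : ℕ) : sqrtNat n * sqrtNat n = n := by
  rw [sqrtNat, ← Complex.ofReal_mul, Real.mul_self_sqrt n.cast_nonneg, Complex.ofReal_natCast]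

lemma sqrtNat_succ_ne_zero (n : ℕ) : sqrtNat (n + 1) ≠ 0 := by
  intro h
  have h2 := sqrtNat_mul_self (n + 1)
  rw [h, mul_zero] at h2
  exact n.succ_ne_zero (by exact_mod_cast h2.symm)

/-- An exponential bound suffices, since it is used against rows of `D` that decay faster than any
exponential. -/
lemma norm_sqrtNat_le (n : ℕ) : ‖sqrtNat n‖ ≤ 2 ^ n := by
  rw [sqrtNat, Complex.norm_real, Real.norm_of_nonneg (Real.sqrt_nonneg _)]
  refine Real.sqrt_le_iff.2 ⟨by positivity, ?_⟩
  have h : (n : ℝ) ≤ 2 ^ n := by exact_mod_cast n.lt_two_pow_self.le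
  have h1 : (1 : ℝ) ≤ 2 ^ n := one_le_pow₀ (by norm_num)
  nlinarith

/-- The generator `δ a† - δ* a` of the displacement operator. -/
noncomputable def dispGen (δ : ℂ) : Matrix ℕ ℕ ℂ := δ • create - conj δ • annih

lemma dispGen_apply (δ : ℂ) (i j : ℕ) : dispGen δ i j =
    (if i = j + 1 then δ * sqrtNat i else 0)
      - (if j = i + 1 then conj δ * sqrtNat j else 0) := by
  simp only [dispGen, annih, create, Matrix.sub_apply, Matrix.smul_apply,
    Matrix.conjTranspose_apply, smul_eq_mul, sqrtNat]
  split_ifs <;> simp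

/-- The truncated `i - 1` at `i = 0` is harmless because its coefficient `sqrtNat 0` vanishes. The
same convention runs through all later recursions. -/
lemma opMul_dispGen (δ : ℂ) {ι : Type*} (B : Matrix ℕ ι ℂ) (i : ℕ) (n : ι) :
    opMul (dispGen δ) B i n =
      δ * sqrtNat i * B (i - 1) n
        - conj δ * sqrtNat (i + 1) * B (i + 1) n := by
  unfold opMul
  rw [tsum_eq_sum (s := {i - 1, i + 1})]
  · rw [Finset.sum_pair (by omega), dispGen_apply, dispGen_apply]
    rcases i with _ | i
    · simp
    · have : ¬ i = i + 1 + 1 := by omega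
      simp only [Nat.add_sub_cancel, this, if_true, if_false,
        if_neg (show ¬ i + 1 = i + 1 + 1 + 1 by omega)]
      ring
  · intro k hk
    simp only [Finset.mem_insert, Finset.mem_singleton, not_or] at hk
    rw [dispGen_apply, if_neg (by omega), if_neg (by omega)]
    simp

lemma opPow_dispGen_succ (δ : ℂ) (k m n : ℕ) :
    opPow (dispGen δ) (k + 1) m n =
      δ * sqrtNat m * opPow (dispGen δ) k (m - 1) n
        - conj δ * sqrtNat (m + 1) * opPow (dispGen δ) k (m + 1) n :=
  opMul_dispGen δ _ m n

/-- The factor `k` kills the truncated case `k = 0`, so the recursion can be used inside inductions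
without a case split. -/
lemma natCast_mul_opPow_dispGen (δ : ℂ) (k m n : ℕ) :
    (k : ℂ) * opPow (dispGen δ) k m n =
      k * (δ * sqrtNat m * opPow (dispGen δ) (k - 1) (m - 1) n
        - conj δ * sqrtNat (m + 1) * opPow (dispGen δ) (k - 1) (m + 1) n) := by
  rcases k with _ | k
  · simp
  · rw [opPow_dispGen_succ, Nat.add_sub_cancel]

/-- Commutation of the annihilation operator with powers of the generator. -/
lemma opPow_dispGen_row (δ : ℂ) (k m n : ℕ) :
    sqrtNat (m + 1) * opPow (dispGen δ) k (m + 1) n =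
      sqrtNat n * opPow (dispGen δ) k m (n - 1)
        + k * δ * opPow (dispGen δ) (k - 1) m n := by
  induction k generalizing m n with
  | zero =>
    rcases n with _ | n
    · simp [opPow]
    · by_cases h : m = n <;> simp [opPow, Matrix.one_apply, h]
  | succ k ih =>
    -- One generator is split off on the left and the induction hypothesis is applied in the
    -- neighbouring rows. The squares `e1`, `e4` leave `(m + 1) - m = 1`, the commutator `[a, a†]`;
    -- `hY` reassembles `k` copies of the `k`-th power.
    have e1 := sqrtNat_mul_self (m + 1)
    have e2 := ih (m + 1) n
    have e4 := sqrtNat_mul_self m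
    have hY := natCast_mul_opPow_dispGen δ k m n
    rw [opPow_dispGen_succ, opPow_dispGen_succ]
    simp only [Nat.add_sub_cancel] at *
    rcases m with _ | m
    · rw [sqrtNat_zero] at *
      push_cast at *
      linear_combination δ * opPow (dispGen δ) k 0 n * e1
        - conj δ * sqrtNat (0 + 1) * e2 - δ * hY
    · have e3 := ih m n
      simp only [Nat.add_sub_cancel] at *
      push_cast at *
      linear_combination δ * opPow (dispGen δ) k (m + 1) n * e1
        - conj δ * sqrtNat (m + 1 + 1) * e2 - δ * hY
        + δ * sqrtNat (m + 1) * e3 - δ * opPow (dispGen δ) k (m + 1) n * e4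

/-- Commutation of the creation operator with powers of the generator. -/
lemma opPow_dispGen_col (δ : ℂ) (k m n : ℕ) :
    sqrtNat (n + 1) * opPow (dispGen δ) k m (n + 1) =
      sqrtNat m * opPow (dispGen δ) k (m - 1) n
        - k * conj δ * opPow (dispGen δ) (k - 1) m n := by
  induction k generalizing m n with
  | zero =>
    rcases m with _ | m
    · simp [opPow]
    · by_cases h : m = n <;> simp [opPow, Matrix.one_apply, h]
  | succ k ih =>
    have e1 := sqrtNat_mul_self (m + 1)
    have e2 := ih (m + 1) n
    have e3 := ih (m - 1) n
    have e4 := sqrtNat_mul_self m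
    have hY := natCast_mul_opPow_dispGen δ k m n
    rw [opPow_dispGen_succ, opPow_dispGen_succ]
    simp only [Nat.add_sub_cancel] at *
    rcases m with _ | m
    · rw [sqrtNat_zero] at *
      push_cast at *
      linear_combination - conj δ * sqrtNat (0 + 1) * e2 + conj δ * hY
        - conj δ * opPow (dispGen δ) k 0 n * e1
    · simp only [Nat.add_sub_cancel] at *
      push_cast at *
      linear_combination δ * sqrtNat (m + 1) * e3
        - conj δ * sqrtNat (m + 1 + 1) * e2 + conj δ * hY
        - conj δ * opPow (dispGen δ) k (m + 1) n * e1
        + conj δ * opPow (dispGen δ) k (m + 1) n * e4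

/-- From the vacuum row the leftmost generator reaches only row 1, and the commutation relation
brings it back. This is the recursion of Gaussian moments, whence the exponential of `-|δ|²/2`. -/
lemma opPow_dispGen_zero_zero (δ : ℂ) (k : ℕ) :
    opPow (dispGen δ) (k + 2) 0 0 = -(k + 1) * (δ * conj δ) * opPow (dispGen δ) k 0 0 := by
  have h := opPow_dispGen_row δ (k + 1) 0 0
  rw [opPow_dispGen_succ δ (k + 1)]
  simp only [sqrtNat_zero, Nat.add_sub_cancel] at *
  push_cast at *
  linear_combination -conj δ * h

lemma opPow_dispGen_even (δ : ℂ) (k : ℕ) :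
    (((2 * k).factorial : ℂ))⁻¹ * opPow (dispGen δ) (2 * k) 0 0 =
      (-(δ * conj δ) / 2) ^ k / k.factorial := by
  induction k with
  | zero => simp [opPow]
  | succ k ih =>
    have h1 : ((2 * k).factorial : ℂ) ≠ 0 := by exact_mod_cast (2 * k).factorial_ne_zero
    have h2 : (k.factorial : ℂ) ≠ 0 := by exact_mod_cast k.factorial_ne_zero
    have h3 : (2 * (k : ℂ) + 1) ≠ 0 := by exact_mod_cast Nat.succ_ne_zero (2 * k)
    have h4 : ((k : ℂ) + 1) ≠ 0 := by exact_mod_cast Nat.succ_ne_zero k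
    rw [show 2 * (k + 1) = 2 * k + 2 by ring, opPow_dispGen_zero_zero, pow_succ, Nat.factorial_succ,
      Nat.factorial_succ, Nat.factorial_succ]
    have : opPow (dispGen δ) (2 * k) 0 0
        = (2 * k).factorial * ((-(δ * conj δ) / 2) ^ k / k.factorial) := by
      rw [← ih]; field_simp
    rw [this]
    push_cast
    have h5 : (2 * (k : ℂ) + 1 + 1) ≠ 0 := by exact_mod_cast Nat.succ_ne_zero (2 * k + 1)
    field_simp
    ring

lemma opPow_dispGen_odd (δ : ℂ) (k : ℕ) : opPow (dispGen δ) (2 * k + 1) 0 0 = 0 := by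
  induction k with
  | zero => rw [opPow_dispGen_succ]; simp [opPow]
  | succ k ih =>
    rw [show 2 * (k + 1) + 1 = (2 * k + 1) + 2 by ring, opPow_dispGen_zero_zero, ih, mul_zero]

/-- The terms of the exponential series of the displacement operator. -/
noncomputable def dispTerm (δ : ℂ) (m n k : ℕ) : ℂ :=
  ((k.factorial : ℂ))⁻¹ * opPow (dispGen δ) k m n

lemma hasSum_dispTerm_zero_zero (δ : ℂ) :
    HasSum (dispTerm δ 0 0) (Complex.exp (-(δ * conj δ) / 2)) := by
  rw [← add_zero (Complex.exp _)]
  refine HasSum.even_add_odd ?_ ?_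
  · simp only [dispTerm, opPow_dispGen_even]
    rw [Complex.exp_eq_exp_ℂ]
    exact NormedSpace.expSeries_div_hasSum_exp (𝔸 := ℂ) _
  · simp [dispTerm, opPow_dispGen_odd]

/-- Multiplying the `k`-th power by `k` shifts the exponential series. -/
lemma hasSum_dispTerm_shift {δ : ℂ} {m n : ℕ} {s : ℂ} (h : HasSum (dispTerm δ m n) s) :
    HasSum (fun k : ℕ => ((k.factorial : ℂ))⁻¹ * (k * opPow (dispGen δ) (k - 1) m n)) s := by
  rw [← hasSum_nat_add_iff' 1]
  simp only [Finset.range_one, Finset.sum_singleton, Nat.cast_zero, zero_mul, mul_zero, sub_zero]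
  refine h.congr_fun ?_
  intro k
  have h1 : (k.factorial : ℂ) ≠ 0 := by exact_mod_cast k.factorial_ne_zero
  have h4 : ((k : ℂ) + 1) ≠ 0 := by exact_mod_cast Nat.succ_ne_zero k
  rw [dispTerm, Nat.factorial_succ, Nat.add_sub_cancel]
  push_cast
  field_simp

/-- The generator is unbounded, so no norm estimate gives convergence. Summability spreads instead
from the vacuum entry: along row 0 by the column relation, then downwards by the row relation. -/
lemma summable_dispTerm (δ : ℂ) (m n : ℕ) : Summable (dispTerm δ m n) := by
  have h0 : ∀ n, Summable (dispTerm δ 0 n) := by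
    intro n
    induction n with
    | zero => exact (hasSum_dispTerm_zero_zero δ).summable
    | succ n ih =>
      rw [← summable_mul_left_iff (sqrtNat_succ_ne_zero n)]
      refine ((hasSum_dispTerm_shift ih.hasSum).mul_left (-conj δ)).summable.congr fun k => ?_
      have := opPow_dispGen_col δ k 0 n
      rw [sqrtNat_zero] at this
      rw [dispTerm]
      linear_combination -((k.factorial : ℂ))⁻¹ * this
  induction m generalizing n with
  | zero => exact h0 n
  | succ m ih =>
    rw [← summable_mul_left_iff (sqrtNat_succ_ne_zero m)]
    refine (((ih (n - 1)).hasSum.mul_left (sqrtNat n)).add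
      ((hasSum_dispTerm_shift (ih n).hasSum).mul_left δ)).summable.congr fun k => ?_
    have := opPow_dispGen_row δ k m n
    simp only [dispTerm]
    linear_combination -((k.factorial : ℂ))⁻¹ * this

lemma hasSum_dispTerm (δ : ℂ) (m n : ℕ) : HasSum (dispTerm δ m n) (displacement δ m n) :=
  (summable_dispTerm δ m n).hasSum

/-- `a D(δ) = D(δ) (a + δ)`. -/
lemma displacement_row (δ : ℂ) (m n : ℕ) :
    sqrtNat (m + 1) * displacement δ (m + 1) n =
      sqrtNat n * displacement δ m (n - 1) + δ * displacement δ m n := by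
  refine ((hasSum_dispTerm δ (m + 1) n).mul_left _).unique
    ((((hasSum_dispTerm δ m (n - 1)).mul_left (sqrtNat n)).add
      ((hasSum_dispTerm_shift (hasSum_dispTerm δ m n)).mul_left δ)).congr_fun fun k => ?_)
  have := opPow_dispGen_row δ k m n
  simp only [dispTerm]
  linear_combination ((k.factorial : ℂ))⁻¹ * this

/-- `D(δ) a† = (a† - δ*) D(δ)`. -/
lemma displacement_col (δ : ℂ) (m n : ℕ) :
    sqrtNat (n + 1) * displacement δ m (n + 1) =
      sqrtNat m * displacement δ (m - 1) n - conj δ * displacement δ m n := by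
  refine ((hasSum_dispTerm δ m (n + 1)).mul_left _).unique
    ((((hasSum_dispTerm δ (m - 1) n).mul_left (sqrtNat m)).sub
      ((hasSum_dispTerm_shift (hasSum_dispTerm δ m n)).mul_left (conj δ))).congr_fun fun k => ?_)
  have := opPow_dispGen_col δ k m n
  simp only [dispTerm]
  linear_combination ((k.factorial : ℂ))⁻¹ * this

lemma displacement_zero_zero (δ : ℂ) :
    displacement δ 0 0 = Complex.exp (-(δ * conj δ) / 2) :=
  (hasSum_dispTerm δ 0 0).unique (hasSum_dispTerm_zero_zero δ)

/-! ### Matrix elements of the local measurement operator -/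

/-- These are the Poisson weights of a coherent state; the column relation times its conjugate gives
the ratio of consecutive weights. -/
lemma displacement_zero_mul_conj (δ : ℂ) (k : ℕ) :
    displacement δ 0 k * conj (displacement δ 0 k) =
      Complex.exp (-(δ * conj δ)) * ((δ * conj δ) ^ k / k.factorial) := by
  induction k with
  | zero =>
    rw [displacement_zero_zero, ← Complex.exp_conj, ← Complex.exp_add]
    simp only [map_div₀, map_neg, map_mul, Complex.conj_conj, Complex.conj_ofNat, pow_zero,
      Nat.factorial_zero, Nat.cast_one, div_one, mul_one]
    congr 1
    ring
  | succ k ih =>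
    have h := displacement_col δ 0 k
    have h2 := congrArg conj h
    simp only [sqrtNat_zero, map_mul, map_sub, conj_sqrtNat, Complex.conj_conj, map_zero] at h2
    rw [sqrtNat_zero] at h
    have h3 := sqrtNat_mul_self (k + 1)
    have h4 : ((k : ℂ) + 1) ≠ 0 := by exact_mod_cast Nat.succ_ne_zero k
    have h5 : (k.factorial : ℂ) ≠ 0 := by exact_mod_cast k.factorial_ne_zero
    have h6 : ((k : ℂ) + 1) * (displacement δ 0 (k + 1) * conj (displacement δ 0 (k + 1))) =
        (δ * conj δ) * (displacement δ 0 k * conj (displacement δ 0 k)) := by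
      push_cast at h3
      linear_combination sqrtNat (k + 1) * conj (displacement δ 0 (k + 1)) * h
        - conj δ * displacement δ 0 k * h2
        - displacement δ 0 (k + 1) * conj (displacement δ 0 (k + 1)) * h3
    rw [ih] at h6
    rw [← mul_right_inj' h4, h6, Nat.factorial_succ, pow_succ]
    push_cast
    field_simp

lemma mul_conj_eq_ofReal (z : ℂ) : z * conj z = ((‖z‖ ^ 2 : ℝ) : ℂ) := by
  rw [Complex.mul_conj, Complex.normSq_eq_norm_sq]

lemma norm_displacement_zero_sq (δ : ℂ) (k : ℕ) :
    ‖displacement δ 0 k‖ ^ 2 = Real.exp (-‖δ‖ ^ 2) * ((‖δ‖ ^ 2) ^ k / k.factorial) := by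
  have h := displacement_zero_mul_conj δ k
  rw [mul_conj_eq_ofReal, mul_conj_eq_ofReal] at h
  exact_mod_cast h

/-- The rows of the displacement operator decay faster than any exponential. -/
lemma exists_norm_displacement_le (δ : ℂ) (m : ℕ) {A : ℝ} (hA : 0 < A) :
    ∃ B, ∀ k, ‖displacement δ m k‖ * A ^ k ≤ B := by
  induction m generalizing A with
  | zero =>
    -- The exponential bounds the square of the quantity, and `x ≤ 1 + x²`.
    refine ⟨1 + Real.exp (A ^ 2 * ‖δ‖ ^ 2), fun k => ?_⟩
    have h1 : (‖displacement δ 0 k‖ * A ^ k) ^ 2 ≤ Real.exp (A ^ 2 * ‖δ‖ ^ 2) := by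
      rw [mul_pow, norm_displacement_zero_sq]
      have h2 := Real.pow_div_factorial_le_exp (A ^ 2 * ‖δ‖ ^ 2) (by positivity) k
      have h3 : Real.exp (-‖δ‖ ^ 2) ≤ 1 := Real.exp_le_one_iff.2 (by nlinarith [sq_nonneg ‖δ‖])
      calc Real.exp (-‖δ‖ ^ 2) * ((‖δ‖ ^ 2) ^ k / k.factorial) * (A ^ k) ^ 2
          = Real.exp (-‖δ‖ ^ 2) * ((A ^ 2 * ‖δ‖ ^ 2) ^ k / k.factorial) := by ring
        _ ≤ 1 * ((A ^ 2 * ‖δ‖ ^ 2) ^ k / k.factorial) := by gcongr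
        _ ≤ _ := by rwa [one_mul]
    nlinarith [sq_nonneg (‖displacement δ 0 k‖ * A ^ k - 1),
      Real.exp_pos (A ^ 2 * ‖δ‖ ^ 2)]
  | succ m ih =>
    -- Decay at the doubled base absorbs the factor `√k ≤ 2 ^ k` of the row recursion; this is why
    -- `A` is generalised.
    obtain ⟨B₁, h₁⟩ := ih (A := 2 * A) (by positivity)
    obtain ⟨B₂, h₂⟩ := ih hA
    have hB₁ : 0 ≤ B₁ := le_trans (by positivity) (h₁ 0)
    refine ⟨2 * A * B₁ + ‖δ‖ * B₂, fun k => ?_⟩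
    have hs : (1 : ℝ) ≤ ‖sqrtNat (m + 1)‖ := by
      rw [sqrtNat, Complex.norm_real, Real.norm_of_nonneg (Real.sqrt_nonneg _),
        Real.one_le_sqrt]
      push_cast
      linarith [(m.cast_nonneg : (0 : ℝ) ≤ m)]
    have h := displacement_row δ m k
    have h3 : ‖sqrtNat k * displacement δ m (k - 1)‖ * A ^ k ≤ 2 * A * B₁ := by
      rcases k with _ | k
      · simp only [sqrtNat_zero, zero_mul, norm_zero]
        positivity
      · rw [Nat.add_sub_cancel, norm_mul]
        calc ‖sqrtNat (k + 1)‖ * ‖displacement δ m k‖ * A ^ (k + 1)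
            ≤ 2 ^ (k + 1) * ‖displacement δ m k‖ * A ^ (k + 1) := by
              gcongr; exact norm_sqrtNat_le _
          _ = 2 * A * (‖displacement δ m k‖ * (2 * A) ^ k) := by ring
          _ ≤ _ := by gcongr; exact h₁ k
    calc ‖displacement δ (m + 1) k‖ * A ^ k
        ≤ ‖sqrtNat (m + 1)‖ * ‖displacement δ (m + 1) k‖ * A ^ k := by
          gcongr
          exact le_mul_of_one_le_left (norm_nonneg _) hs
      _ = ‖sqrtNat k * displacement δ m (k - 1) + δ * displacement δ m k‖ * A ^ k := by
          rw [← norm_mul, h]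
      _ ≤ (‖sqrtNat k * displacement δ m (k - 1)‖ + ‖δ‖ * ‖displacement δ m k‖) * A ^ k := by
          gcongr
          rw [← norm_mul]
          exact norm_add_le _ _
      _ = ‖sqrtNat k * displacement δ m (k - 1)‖ * A ^ k
            + ‖δ‖ * (‖displacement δ m k‖ * A ^ k) := by ring
      _ ≤ _ := by gcongr; exact h₂ k

lemma localNoClick_apply (η : ℝ) (δ : ℂ) (m n : ℕ) : localNoClick η δ m n =
    ∑' k, (1 - (η : ℂ)) ^ k * (displacement δ m k * conj (displacement δ n k)) := by
  rw [localNoClick, opMul]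
  refine tsum_congr fun k => ?_
  rw [opMul, tsum_eq_single k]
  · rw [noClick, Matrix.diagonal_apply_eq, Matrix.conjTranspose_apply]
    simp only [RCLike.star_def]
    ring
  · intro j hj
    rw [noClick, Matrix.diagonal_apply_ne _ hj, mul_zero]

lemma norm_one_sub_pow_le {η : ℝ} (h0 : 0 ≤ η) (h1 : η ≤ 1) (k : ℕ) :
    ‖(1 - (η : ℂ)) ^ k‖ ≤ 1 := by
  have : (1 - (η : ℂ)) = ((1 - η : ℝ) : ℂ) := by push_cast; ring
  rw [norm_pow, this, Complex.norm_real, Real.norm_of_nonneg (by linarith)]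
  exact pow_le_one₀ (by linarith) (by linarith)

lemma summable_norm_displacement_mul (δ : ℂ) (m n : ℕ) :
    Summable fun k => ‖displacement δ m k * conj (displacement δ n k)‖ := by
  obtain ⟨B₁, h₁⟩ := exists_norm_displacement_le δ m (A := 2) (by norm_num)
  obtain ⟨B₂, h₂⟩ := exists_norm_displacement_le δ n (A := 2) (by norm_num)
  refine Summable.of_nonneg_of_le (fun _ => norm_nonneg _) (fun k => ?_)
    ((summable_geometric_of_lt_one (r := (1 / 4 : ℝ)) (by norm_num) (by norm_num)).mul_left
      (B₁ * B₂))
  rw [norm_mul, RCLike.norm_conj]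
  have h3 := mul_le_mul (h₁ k) (h₂ k) (by positivity) (le_trans (by positivity) (h₁ k))
  have h4 : (1 / 4 : ℝ) ^ k = ((2 : ℝ) ^ k * 2 ^ k)⁻¹ := by
    rw [← mul_pow, one_div, inv_pow]; norm_num
  rw [h4, ← div_eq_mul_inv, le_div_iff₀ (by positivity)]
  linarith

lemma hasSum_localNoClick {η : ℝ} (h0 : 0 ≤ η) (h1 : η ≤ 1) (δ : ℂ) (m n : ℕ) :
    HasSum (fun k => (1 - (η : ℂ)) ^ k * (displacement δ m k * conj (displacement δ n k)))
      (localNoClick η δ m n) := by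
  rw [localNoClick_apply]
  refine (Summable.of_norm_bounded (summable_norm_displacement_mul δ m n) fun k => ?_).hasSum
  rw [norm_mul]
  exact mul_le_of_le_one_left (norm_nonneg _) (norm_one_sub_pow_le h0 h1 k)

lemma conj_localNoClick {η : ℝ} (h0 : 0 ≤ η) (h1 : η ≤ 1) (δ : ℂ) (m n : ℕ) :
    conj (localNoClick η δ m n) = localNoClick η δ n m := by
  refine ((Complex.hasSum_conj'.2 (by simpa using hasSum_localNoClick h0 h1 δ m n))).unique
    ((hasSum_localNoClick h0 h1 δ n m).congr_fun fun k => ?_)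
  simp only [map_mul, map_pow, map_sub, map_one, Complex.conj_ofReal, Complex.conj_conj]
  ring

lemma localNoClick_zero_zero {η : ℝ} (h0 : 0 ≤ η) (h1 : η ≤ 1) (δ : ℂ) :
    localNoClick η δ 0 0 = Complex.exp (-(η * (δ * conj δ))) := by
  have h := (NormedSpace.expSeries_div_hasSum_exp (𝔸 := ℂ)
    ((1 - (η : ℂ)) * (δ * conj δ))).mul_left (Complex.exp (-(δ * conj δ)))
  rw [← Complex.exp_eq_exp_ℂ, ← Complex.exp_add] at h
  rw [show -(η * (δ * conj δ)) = -(δ * conj δ) + (1 - (η : ℂ)) * (δ * conj δ) by ring]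
  refine (hasSum_localNoClick h0 h1 δ 0 0).unique (h.congr_fun fun k => ?_)
  rw [displacement_zero_mul_conj, mul_pow (1 - (η : ℂ)) (δ * conj δ) k]
  ring

/-- The commutation relation `(a - δ) M₀ = (1 - η) M₀ (a - δ)`. -/
lemma localNoClick_row {η : ℝ} (h0 : 0 ≤ η) (h1 : η ≤ 1) (δ : ℂ) (m n : ℕ) :
    sqrtNat (m + 1) * localNoClick η δ (m + 1) n =
      η * δ * localNoClick η δ m n + (1 - η) * sqrtNat n * localNoClick η δ m (n - 1) := by
  -- Shifting `k` by one produces the factor `1 - η`; the conjugated column relation then moves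
  -- `√(k+1)` onto the index `n`.
  have hs : HasSum (fun k => (1 - (η : ℂ)) ^ k *
      (sqrtNat k * displacement δ m (k - 1) * conj (displacement δ n k)))
      ((1 - η) * (sqrtNat n * localNoClick η δ m (n - 1) - δ * localNoClick η δ m n)) := by
    rw [← hasSum_nat_add_iff' 1]
    simp only [Finset.range_one, Finset.sum_singleton, sqrtNat_zero, zero_mul, mul_zero, sub_zero,
      Nat.add_sub_cancel]
    refine ((((hasSum_localNoClick h0 h1 δ m (n - 1)).mul_left (sqrtNat n)).sub
      ((hasSum_localNoClick h0 h1 δ m n).mul_left δ)).mul_left (1 - (η : ℂ))).congr_fun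
      fun k => ?_
    have h := congrArg conj (displacement_col δ n k)
    simp only [map_mul, map_sub, conj_sqrtNat, Complex.conj_conj] at h
    linear_combination (1 - (η : ℂ)) ^ (k + 1) * displacement δ m k * h
  have hs2 := hs.add ((hasSum_localNoClick h0 h1 δ m n).mul_left δ)
  refine (((hasSum_localNoClick h0 h1 δ (m + 1) n).mul_left (sqrtNat (m + 1))).unique
    (hs2.congr_fun fun k => ?_)).trans (by ring)
  linear_combination (1 - (η : ℂ)) ^ k * conj (displacement δ n k) * displacement_row δ m k

lemma localNoClick_col {η : ℝ} (h0 : 0 ≤ η) (h1 : η ≤ 1) (δ : ℂ) (m n : ℕ) :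
    sqrtNat (n + 1) * localNoClick η δ m (n + 1) =
      η * conj δ * localNoClick η δ m n + (1 - η) * sqrtNat m * localNoClick η δ (m - 1) n := by
  have h := congrArg conj (localNoClick_row h0 h1 δ n m)
  simpa only [map_mul, map_add, map_sub, map_one, conj_sqrtNat, conj_localNoClick h0 h1,
    Complex.conj_ofReal] using h

/-- This is `D D† = 1`. At `η = 0` the row and column relations say that `M₀` commutes with `a` and
`a†`; with vacuum entry 1 this forces the identity. -/
lemma localNoClick_zero_left (δ : ℂ) : localNoClick 0 δ = 1 := by
  have a0 : (0 : ℝ) ≤ 0 := le_rfl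
  have a1 : (0 : ℝ) ≤ 1 := zero_le_one
  have h0 : ∀ n, localNoClick 0 δ 0 n = (1 : Matrix ℕ ℕ ℂ) 0 n := by
    intro n
    rcases n with _ | n
    · rw [localNoClick_zero_zero a0 a1]; simp
    · have h := localNoClick_col a0 a1 δ 0 n
      simp only [Complex.ofReal_zero, zero_mul, sqrtNat_zero, mul_zero, add_zero] at h
      simpa using (mul_eq_zero.1 h).resolve_left (sqrtNat_succ_ne_zero n)
  ext m n
  induction m generalizing n with
  | zero => exact h0 n
  | succ m ih =>
    have h := localNoClick_row a0 a1 δ m n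
    rw [ih, ih] at h
    rw [← mul_right_inj' (sqrtNat_succ_ne_zero m), h]
    rcases n with _ | n
    · simp
    · by_cases hmn : m = n <;> simp [Matrix.one_apply, hmn]

lemma hasSum_norm_displacement_sq (δ : ℂ) (m : ℕ) :
    HasSum (fun k => ‖displacement δ m k‖ ^ 2) 1 := by
  have h := hasSum_localNoClick le_rfl zero_le_one δ m m
  rw [localNoClick_zero_left, Matrix.one_apply_eq] at h
  rw [← Complex.hasSum_ofReal]
  refine (h.congr_fun fun k => ?_)
  rw [mul_conj_eq_ofReal]
  simp

/-- The rows of `D` are unit vectors, so `xy ≤ (x² + y²)/2` bounds the sum termwise. -/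
lemma norm_localNoClick_le {η : ℝ} (h0 : 0 ≤ η) (h1 : η ≤ 1) (δ : ℂ) (m n : ℕ) :
    ‖localNoClick η δ m n‖ ≤ 1 := by
  have h := ((hasSum_norm_displacement_sq δ m).add (hasSum_norm_displacement_sq δ n)).mul_left
    (1 / 2)
  rw [localNoClick_apply]
  refine (tsum_of_norm_bounded h fun k => ?_).trans (by norm_num)
  rw [norm_mul]
  refine (mul_le_of_le_one_left (norm_nonneg _) (norm_one_sub_pow_le h0 h1 k)).trans ?_
  rw [norm_mul, RCLike.norm_conj]
  nlinarith [sq_nonneg (‖displacement δ m k‖ - ‖displacement δ n k‖)]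

/-! ### Generating functions of the local measurement operator -/

/-- The generating function `∑ cⁱ ⟨i|M₀|i⟩`. -/
noncomputable def diagGen (η : ℝ) (δ c : ℂ) : ℂ := ∑' i : ℕ, c ^ i * localNoClick η δ i i

/-- The derivative of `diagGen`. -/
noncomputable def diagGenDeriv (η : ℝ) (δ c : ℂ) : ℂ :=
  ∑' i : ℕ, i * c ^ (i - 1) * localNoClick η δ i i

/-- The generating function `∑ cⁱ √(i+1) ⟨i+1|M₀|i⟩`. -/
noncomputable def offDiagGen (η : ℝ) (δ c : ℂ) : ℂ :=
  ∑' i : ℕ, c ^ i * sqrtNat (i + 1) * localNoClick η δ (i + 1) i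

lemma norm_sqrtNat_succ_le (i : ℕ) : ‖sqrtNat (i + 1)‖ ≤ i + 1 := by
  rw [sqrtNat, Complex.norm_real, Real.norm_of_nonneg (Real.sqrt_nonneg _), Real.sqrt_le_left
    (by positivity)]
  push_cast
  nlinarith [(i.cast_nonneg : (0 : ℝ) ≤ i)]

lemma summable_succ_mul_pow {x : ℝ} (h0 : 0 ≤ x) (h1 : x < 1) :
    Summable fun i : ℕ => ((i : ℝ) + 1) * x ^ i := by
  have h := summable_pow_mul_geometric_of_norm_lt_one 1
    (show ‖x‖ < 1 by rwa [Real.norm_of_nonneg h0])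
  refine (h.add (summable_geometric_of_lt_one h0 h1)).congr fun i => ?_
  ring

lemma summable_natCast_mul_pow_pred {x : ℝ} (h0 : 0 ≤ x) (h1 : x < 1) :
    Summable fun i : ℕ => (i : ℝ) * x ^ (i - 1) := by
  rw [← summable_nat_add_iff 1]
  exact (summable_succ_mul_pow h0 h1).congr fun i => by simp

section

variable {η : ℝ} (h0 : 0 ≤ η) (h1 : η ≤ 1) (δ : ℂ) {c : ℂ} (hc : ‖c‖ < 1)
include h0 h1 hc

lemma hasSum_diagGen :
    HasSum (fun i : ℕ => c ^ i * localNoClick η δ i i) (diagGen η δ c) := by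
  refine (Summable.of_norm_bounded (summable_geometric_of_lt_one (norm_nonneg c) hc)
    fun i => ?_).hasSum
  rw [norm_mul, norm_pow]
  exact mul_le_of_le_one_right (by positivity) (norm_localNoClick_le h0 h1 δ i i)

lemma hasSum_diagGenDeriv :
    HasSum (fun i : ℕ => i * c ^ (i - 1) * localNoClick η δ i i) (diagGenDeriv η δ c) := by
  refine (Summable.of_norm_bounded (summable_natCast_mul_pow_pred (norm_nonneg c) hc)
    fun i => ?_).hasSum
  rw [norm_mul, norm_mul, norm_pow, Complex.norm_natCast]
  exact mul_le_of_le_one_right (by positivity) (norm_localNoClick_le h0 h1 δ i i)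

lemma hasSum_offDiagGen :
    HasSum (fun i : ℕ => c ^ i * sqrtNat (i + 1) * localNoClick η δ (i + 1) i)
      (offDiagGen η δ c) := by
  refine (Summable.of_norm_bounded (summable_succ_mul_pow (norm_nonneg c) hc)
    fun i => ?_).hasSum
  rw [norm_mul, norm_mul, norm_pow, mul_comm (‖c‖ ^ i)]
  refine (mul_le_of_le_one_right (by positivity) (norm_localNoClick_le h0 h1 δ _ i)).trans ?_
  gcongr
  exact norm_sqrtNat_succ_le i

lemma hasSum_offDiagGen_conj :
    HasSum (fun i : ℕ => c ^ i * sqrtNat (i + 1) * localNoClick η δ i (i + 1))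
      (conj (offDiagGen η δ (conj c))) := by
  have h := hasSum_offDiagGen h0 h1 δ (c := conj c) (by rwa [RCLike.norm_conj])
  refine (Complex.hasSum_conj'.2 h).congr_fun fun i => ?_
  simp only [map_mul, map_pow, Complex.conj_conj, conj_sqrtNat, conj_localNoClick h0 h1]

lemma one_sub_mul_ne_zero : 1 - (1 - (η : ℂ)) * c ≠ 0 := by
  intro h
  have h2 : ‖(1 - (η : ℂ)) * c‖ < 1 := by
    rw [norm_mul]
    have := norm_one_sub_pow_le h0 h1 1
    rw [pow_one] at this
    exact (mul_le_of_le_one_left (norm_nonneg c) this).trans_lt hc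
  rw [sub_eq_zero] at h
  rw [← h, norm_one] at h2
  exact lt_irrefl _ h2

/-- Multiplying `localNoClick_row` at `(i, i)` by `c ^ i` and summing gives a linear equation: the
term with `√i` is `c` times the unknown series itself. -/
lemma offDiagGen_eq :
    offDiagGen η δ c = η * δ * diagGen η δ c / (1 - (1 - (η : ℂ)) * c) := by
  have hs : HasSum (fun i : ℕ => c ^ i * sqrtNat i * localNoClick η δ i (i - 1))
      (c * offDiagGen η δ c) := by
    rw [← hasSum_nat_add_iff' 1]
    simp only [Finset.range_one, Finset.sum_singleton, sqrtNat_zero, zero_mul, mul_zero, sub_zero,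
      Nat.add_sub_cancel]
    refine ((hasSum_offDiagGen h0 h1 δ hc).mul_left c).congr_fun fun i => ?_
    ring
  rw [eq_div_iff (one_sub_mul_ne_zero h0 h1 hc)]
  have h := (hasSum_offDiagGen h0 h1 δ hc).unique
    ((((hasSum_diagGen h0 h1 δ hc).mul_left (η * δ)).add (hs.mul_left (1 - (η : ℂ)))).congr_fun
      fun i => ?_)
  · linear_combination h
  · linear_combination c ^ i * localNoClick_row h0 h1 δ i i

lemma conj_diagGen : conj (diagGen η δ (conj c)) = diagGen η δ c := by
  have h := hasSum_diagGen h0 h1 δ (c := conj c) (by rwa [RCLike.norm_conj])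
  refine (Complex.hasSum_conj'.2 h).unique
    ((hasSum_diagGen h0 h1 δ hc).congr_fun fun i => ?_)
  simp only [map_mul, map_pow, Complex.conj_conj, conj_localNoClick h0 h1]

lemma conj_offDiagGen_eq :
    conj (offDiagGen η δ (conj c)) =
      η * conj δ * diagGen η δ c / (1 - (1 - (η : ℂ)) * c) := by
  rw [offDiagGen_eq h0 h1 δ (by rwa [RCLike.norm_conj])]
  simp only [map_div₀, map_mul, map_sub, map_one, Complex.conj_ofReal, Complex.conj_conj,
    conj_diagGen h0 h1 δ hc]

/-- The row relation at `(i, i + 1)`, weighted by `c ^ i √(i+1)`, again sums to a linear equation.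
Its solution is the differential equation for `diagGen`. -/
lemma diagGenDeriv_eq :
    diagGenDeriv η δ c = diagGen η δ c / (1 - (1 - (η : ℂ)) * c) *
      (1 - η + η ^ 2 * (δ * conj δ) / (1 - (1 - (η : ℂ)) * c)) := by
  have hT := hasSum_diagGenDeriv h0 h1 δ hc
  have hT1 := (hasSum_nat_add_iff' 1).2 hT
  simp only [Finset.range_one, Finset.sum_singleton, Nat.cast_zero, zero_mul, sub_zero,
      Nat.add_sub_cancel] at hT1
  have h := hT1.unique
    ((((hasSum_offDiagGen_conj h0 h1 δ hc).mul_left (η * δ)).add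
      (((hasSum_diagGen h0 h1 δ hc).add (hT.mul_left c)).mul_left (1 - (η : ℂ)))).congr_fun
      fun i => ?_)
  · rw [conj_offDiagGen_eq h0 h1 δ hc] at h
    have hD := one_sub_mul_ne_zero h0 h1 hc
    have h2 : diagGenDeriv η δ c * (1 - (1 - (η : ℂ)) * c) =
        η * δ * (η * conj δ * diagGen η δ c / (1 - (1 - (η : ℂ)) * c))
          + (1 - η) * diagGen η δ c := by linear_combination h
    rw [eq_div_of_mul_eq hD h2]
    field_simp
    ring
  · have h := localNoClick_row h0 h1 δ i (i + 1)
    have h2 := sqrtNat_mul_self (i + 1)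
    rw [Nat.add_sub_cancel] at h
    have h3 : c * ((i : ℂ) * c ^ (i - 1)) = i * c ^ i := by
      rcases i with _ | i
      · simp
      · rw [Nat.add_sub_cancel, pow_succ]; ring
    push_cast at *
    linear_combination c ^ i * sqrtNat (i + 1) * h
      - c ^ i * localNoClick η δ (i + 1) (i + 1) * h2
      + (1 - η) * c ^ i * localNoClick η δ i i * h2
      - (1 - η) * localNoClick η δ i i * h3

lemma hasDerivAt_diagGen : HasDerivAt (diagGen η δ) (diagGenDeriv η δ c) c := by
  -- On the ball of this intermediate radius the differentiated series has a uniform summable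
  -- majorant.
  obtain ⟨x, hcx, hx1⟩ := exists_between hc
  have hx0 : 0 ≤ x := (norm_nonneg c).trans hcx.le
  refine hasDerivAt_tsum_of_isPreconnected (𝕜 := ℂ) (F := ℂ)
    (t := Metric.ball 0 x) (y₀ := c) (u := fun i : ℕ => (i : ℝ) * x ^ (i - 1))
    (g := fun i c => c ^ i * localNoClick η δ i i)
    (g' := fun i c => i * c ^ (i - 1) * localNoClick η δ i i)
    (summable_natCast_mul_pow_pred hx0 hx1) Metric.isOpen_ball
    (convex_ball 0 x).isPreconnected (fun i y _ => (hasDerivAt_pow i y).mul_const _)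
    (fun i y hy => ?_) (by simpa using hcx) (hasSum_diagGen h0 h1 δ hc).summable
    (by simpa using hcx)
  rw [norm_mul, norm_mul, norm_pow, Complex.norm_natCast]
  refine (mul_le_of_le_one_right (by positivity) (norm_localNoClick_le h0 h1 δ i i)).trans ?_
  have : ‖y‖ ≤ x := (mem_ball_zero_iff.1 hy).le
  gcongr

/-- The generating function of the diagonal matrix elements in closed form. -/
lemma diagGen_eq :
    diagGen η δ c = Complex.exp (-(η * (δ * conj δ) * (1 - c)) / (1 - (1 - (η : ℂ)) * c))
      / (1 - (1 - (η : ℂ)) * c) := by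
  let D : ℂ → ℂ := fun z => 1 - (1 - (η : ℂ)) * z
  -- The added factor is the integrating factor of `diagGenDeriv_eq`: `z / D` has derivative `1 / D
  -- ^ 2`, so `G` is constant on the unit disc.
  let G : ℂ → ℂ := fun z =>
    diagGen η δ z * (D z * Complex.exp (-(η ^ 2 * (δ * conj δ) * z / D z)))
  have hD : ∀ z, HasDerivAt D (-(1 - (η : ℂ))) z := fun z => by
    simpa using ((hasDerivAt_id z).const_mul (1 - (η : ℂ))).const_sub 1
  have hG : ∀ z ∈ Metric.ball (0 : ℂ) 1, HasDerivAt G 0 z := by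
    intro z hz
    have hz1 : ‖z‖ < 1 := by simpa using hz
    have hDz : D z ≠ 0 := one_sub_mul_ne_zero h0 h1 hz1
    have h2 := (hasDerivAt_diagGen h0 h1 δ hz1).mul ((hD z).mul
      ((((hasDerivAt_id z).const_mul (η ^ 2 * (δ * conj δ))).div (hD z) hDz).neg.cexp))
    have h3 : HasDerivAt G _ z := h2
    refine h3.congr_deriv ?_
    rw [diagGenDeriv_eq h0 h1 δ hz1]
    simp only [Pi.neg_apply, Pi.div_apply, Pi.mul_apply, id]
    change diagGen η δ z / D z * (1 - η + η ^ 2 * (δ * conj δ) / D z) *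
      (D z * Complex.exp (-(η ^ 2 * (δ * conj δ) * z / D z))) + _ = _
    have e : D z = 1 - (1 - (η : ℂ)) * z := rfl
    field_simp
    rw [e]
    ring
  have hconst := (convex_ball (0 : ℂ) 1).is_const_of_fderivWithin_eq_zero (𝕜 := ℂ) (f := G)
    (fun z hz => (hG z hz).differentiableAt.differentiableWithinAt)
    (fun z hz => by
      rw [fderivWithin_of_isOpen Metric.isOpen_ball hz, (hG z hz).hasFDerivAt.fderiv]
      ext; simp)
    (show c ∈ Metric.ball (0 : ℂ) 1 by simpa using hc) (show (0 : ℂ) ∈ _ by simp)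
  have hz : diagGen η δ 0 = Complex.exp (-(η * (δ * conj δ))) := by
    rw [← localNoClick_zero_zero h0 h1, diagGen, tsum_eq_single 0]
    · simp
    · intro i hi; simp [hi]
  have hDc : D c ≠ 0 := one_sub_mul_ne_zero h0 h1 hc
  simp only [G, hz] at hconst
  change diagGen η δ c = Complex.exp (-(η * (δ * conj δ) * (1 - c)) / D c) / D c
  rw [eq_div_iff hDc]
  have e : Complex.exp (-(η * (δ * conj δ) * (1 - c)) / D c) =
      Complex.exp (-(η * (δ * conj δ))) * Complex.exp (η ^ 2 * (δ * conj δ) * c / D c) := by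
    rw [← Complex.exp_add]
    congr 1
    have e : D c = 1 - (1 - (η : ℂ)) * c := rfl
    field_simp
    rw [e]
    ring
  rw [e]
  have e0 : Complex.exp (-(η ^ 2 * (δ * conj δ) * c / D c)) *
      Complex.exp (η ^ 2 * (δ * conj δ) * c / D c) = 1 := by
    rw [← Complex.exp_add]; simp
  have e1 : D 0 = 1 := by simp [D]
  rw [e1] at hconst
  simp only [mul_zero, zero_div, neg_zero, Complex.exp_zero, mul_one] at hconst
  rw [← hconst]
  linear_combination -diagGen η δ c * D c * e0

end

/-! ### Beam splitter amplitudes -/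

/-- The amplitude `√(n+p choose n) aⁿ bᵖ` with which `n + p` photons in one port of a beam splitter
are distributed as `(n, p)`. -/
noncomputable def splitAmp (a b : ℂ) (n p : ℕ) : ℂ := sqrtNat ((n + p).choose n) * (a ^ n * b ^ p)

lemma coeff_linear_pow (a b : ℂ) (n p : ℕ) :
    Polynomial.coeff ((Polynomial.C a * Polynomial.X + Polynomial.C b) ^ (n + p)) n =
      a ^ n * b ^ p * (n + p).choose n := by
  rw [add_pow, Polynomial.finsetSum_coeff, Finset.sum_eq_single n]
  · rw [mul_pow, ← Polynomial.C_pow, ← Polynomial.C_pow, ← Polynomial.C_eq_natCast,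
      Polynomial.coeff_mul_C, Polynomial.coeff_mul_C, Polynomial.coeff_C_mul,
      Polynomial.coeff_X_pow_self]
    simp
  · intro m _ hm
    rw [mul_pow, ← Polynomial.C_pow, ← Polynomial.C_pow, ← Polynomial.C_eq_natCast,
      Polynomial.coeff_mul_C, Polynomial.coeff_mul_C, Polynomial.coeff_C_mul,
      Polynomial.coeff_X_pow, if_neg (Ne.symm hm)]
    simp
  · intro h
    exact absurd (Finset.mem_range.2 (by omega)) h

lemma sqrt_factorial_div (n p : ℕ) :
    ((Real.sqrt (n.factorial * p.factorial) / Real.sqrt ((n + p).factorial) : ℝ) : ℂ) *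
      (n + p).choose n = sqrtNat ((n + p).choose n) := by
  have h : (((n + p).choose n : ℕ) : ℝ) * (n.factorial * p.factorial) = (n + p).factorial := by
    rw [← mul_assoc, Nat.choose_symm_add]
    exact_mod_cast Nat.add_choose_mul_factorial_mul_factorial n p
  have h1 : Real.sqrt ((n + p).factorial) =
      Real.sqrt ((n + p).choose n) * Real.sqrt (n.factorial * p.factorial) := by
    rw [← Real.sqrt_mul (Nat.cast_nonneg _), h]
  have h2 : Real.sqrt (n.factorial * p.factorial) ≠ 0 := by
    have h3 : (0 : ℝ) < n.factorial * p.factorial := by positivity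
    exact (Real.sqrt_pos.2 h3).ne'
  have h3 : Real.sqrt ((n + p).choose n) ≠ 0 := by
    have h4 : (0 : ℝ) < (n + p).choose n := by
      exact_mod_cast Nat.choose_pos (Nat.le_add_right n p)
    exact (Real.sqrt_pos.2 h4).ne'
  rw [sqrtNat, ← Complex.ofReal_natCast, ← Complex.ofReal_mul, h1, Complex.ofReal_inj]
  field_simp
  exact (Real.sq_sqrt (Nat.cast_nonneg _)).symm

lemma beamSplitter_left (t φ : ℝ) (n p : ℕ) :
    beamSplitter t φ (n, p) (n + p, 0) =
      splitAmp (Real.sqrt t) (-(Complex.exp (-(Complex.I * φ)) * Real.sqrt (1 - t))) n p := by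
  rw [beamSplitter, if_pos (by simp), sub_eq_add_neg, ← Polynomial.C_neg]
  dsimp only
  rw [pow_zero, mul_one, coeff_linear_pow, Nat.factorial_zero, Nat.cast_one, mul_one, splitAmp,
    ← sqrt_factorial_div]
  ring

lemma beamSplitter_right (t φ : ℝ) (n p : ℕ) :
    beamSplitter t φ (n, p) (0, n + p) =
      splitAmp (Complex.exp (Complex.I * φ) * Real.sqrt (1 - t)) (Real.sqrt t) n p := by
  rw [beamSplitter, if_pos (by simp)]
  dsimp only
  rw [pow_zero, one_mul, coeff_linear_pow, Nat.factorial_zero, Nat.cast_one, one_mul, splitAmp,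
    ← sqrt_factorial_div]
  ring

lemma beamSplitter_eq_zero {t φ : ℝ} {o i : ℕ × ℕ} (h : o.1 + o.2 ≠ i.1 + i.2) :
    beamSplitter t φ o i = 0 := if_neg h

/-- A crude exponential bound; the decay `(1 / 64) ^ n` imposed on the number distributions beats
it. -/
lemma norm_splitAmp_le {a b : ℂ} (ha : ‖a‖ ≤ 1) (hb : ‖b‖ ≤ 1) (n p : ℕ) :
    ‖splitAmp a b n p‖ ≤ 2 ^ (n + p) := by
  rw [splitAmp, norm_mul, norm_mul, norm_pow, norm_pow]
  have h1 : ‖sqrtNat ((n + p).choose n)‖ ≤ 2 ^ (n + p) := by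
    rw [sqrtNat, Complex.norm_real, Real.norm_of_nonneg (Real.sqrt_nonneg _)]
    refine Real.sqrt_le_iff.2 ⟨by positivity, ?_⟩
    have h2 : ((n + p).choose n : ℝ) ≤ 2 ^ (n + p) := by exact_mod_cast Nat.choose_le_two_pow _ _
    have h3 : (1 : ℝ) ≤ 2 ^ (n + p) := one_le_pow₀ (by norm_num)
    nlinarith
  have h2 : ‖a‖ ^ n * ‖b‖ ^ p ≤ 1 :=
    mul_le_one₀ (pow_le_one₀ (norm_nonneg _) ha) (by positivity) (pow_le_one₀ (norm_nonneg _) hb)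
  calc _ ≤ (2 : ℝ) ^ (n + p) * 1 := by gcongr
    _ = _ := mul_one _

lemma splitAmp_zero_left (a b : ℂ) (p : ℕ) : splitAmp a b 0 p = b ^ p := by
  simp [splitAmp]

lemma splitAmp_one_left (a b : ℂ) (p : ℕ) :
    splitAmp a b 1 p = sqrtNat (p + 1) * (a * b ^ p) := by
  simp [splitAmp, add_comm 1 p]

lemma splitAmp_zero_right (a b : ℂ) (n : ℕ) : splitAmp a b n 0 = a ^ n := by
  simp [splitAmp]

/-! ### Photon loss -/

/-- The amplitude of losing `p` photons out of `n + p` in a line of loss `r`. -/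
noncomputable def lossAmp (r : ℝ) (n p : ℕ) : ℂ :=
  splitAmp (Real.sqrt (1 - r)) (-(Real.sqrt r : ℂ)) n p

lemma conj_lossAmp (r : ℝ) (n p : ℕ) : conj (lossAmp r n p) = lossAmp r n p := by
  simp [lossAmp, splitAmp]

lemma norm_lossAmp_le {r : ℝ} (h0 : 0 ≤ r) (h1 : r ≤ 1) (n p : ℕ) :
    ‖lossAmp r n p‖ ≤ 2 ^ (n + p) := by
  refine norm_splitAmp_le ?_ ?_ n p
  · rw [Complex.norm_real, Real.norm_of_nonneg (Real.sqrt_nonneg _)]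
    exact Real.sqrt_le_one.2 (by linarith)
  · rw [norm_neg, Complex.norm_real, Real.norm_of_nonneg (Real.sqrt_nonneg _)]
    exact Real.sqrt_le_one.2 h1

lemma lossAmp_zero_mul {r : ℝ} (h0 : 0 ≤ r) (p : ℕ) :
    lossAmp r 0 p * lossAmp r 0 p = (r : ℂ) ^ p := by
  rw [lossAmp, splitAmp_zero_left, ← mul_pow, neg_mul_neg, ← Complex.ofReal_mul,
    Real.mul_self_sqrt h0]

lemma lossAmp_one (r : ℝ) (p : ℕ) :
    lossAmp r 1 p = sqrtNat (p + 1) * (Real.sqrt (1 - r) : ℂ) * lossAmp r 0 p := by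
  rw [lossAmp, lossAmp, splitAmp_zero_left, splitAmp_one_left, mul_assoc]

/-- Photon-number conservation leaves one input number in each inner sum. -/
lemma loss_apply {ι : Type*} (r : ℝ) (σ : Matrix (ι × ℕ) (ι × ℕ) ℂ) (i j : ι) (k l : ℕ) :
    loss r σ (i, k) (j, l) =
      ∑' p, lossAmp r k p * lossAmp r l p * σ (i, k + p) (j, l + p) := by
  have hU : ∀ n p, beamSplitter (1 - r) 0 (n, p) (n + p, 0) = lossAmp r n p := fun n p => by
    rw [beamSplitter_left, lossAmp]
    simp
  rw [loss]
  refine tsum_congr fun p => ?_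
  rw [tsum_eq_single (k + p), tsum_eq_single (l + p)]
  · dsimp only
    rw [hU, hU, conj_lossAmp]
    ring
  · intro m hm
    rw [beamSplitter_eq_zero (o := (l, p)) (i := (m, 0)) (by simpa using Ne.symm hm), map_zero,
      mul_zero]
  · intro m hm
    rw [beamSplitter_eq_zero (o := (k, p)) (i := (m, 0)) (by simpa using Ne.symm hm)]
    simp

/-! ### Pairing of operators -/

/-- The trace of the product of two single-mode operators. -/
noncomputable def pairing (A M : Matrix ℕ ℕ ℂ) : ℂ := ∑' p : ℕ × ℕ, A p.1 p.2 * M p.2 p.1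

/-- Absolute summability of the matrix elements. -/
def AbsSummable (A : Matrix ℕ ℕ ℂ) : Prop := Summable fun p : ℕ × ℕ => ‖A p.1 p.2‖

lemma AbsSummable.summable_norm {A M : Matrix ℕ ℕ ℂ} (hA : AbsSummable A)
    (hM : ∀ m n, ‖M m n‖ ≤ 1) : Summable fun p : ℕ × ℕ => ‖A p.1 p.2 * M p.2 p.1‖ :=
  Summable.of_nonneg_of_le (fun _ => norm_nonneg _)
    (fun p => by rw [norm_mul]; exact mul_le_of_le_one_right (norm_nonneg _) (hM _ _)) hA

lemma norm_one_apply_le (m n : ℕ) : ‖(1 : Matrix ℕ ℕ ℂ) m n‖ ≤ 1 := by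
  rw [Matrix.one_apply]
  split_ifs <;> simp

lemma AbsSummable.hasSum_diag {A : Matrix ℕ ℕ ℂ} (hA : AbsSummable A) :
    HasSum (fun k => A k k) (pairing A 1) := by
  have h := (hA.summable_norm norm_one_apply_le).of_norm.hasSum
  have hinj : Function.Injective (fun k : ℕ => (k, k)) := fun a b h => (Prod.mk.inj h).1
  rw [← hinj.hasSum_iff] at h
  · refine h.congr_fun fun k => ?_
    simp
  · rintro ⟨i, j⟩ hij
    have : j ≠ i := fun e => hij ⟨i, by rw [e]⟩
    simp [this]

lemma opMul_one {ι κ : Type*} [DecidableEq κ] (A : Matrix ι κ ℂ) :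
    opMul A (1 : Matrix κ κ ℂ) = A := by
  ext i j
  rw [opMul, tsum_eq_single j]
  · simp
  · intro k hk
    rw [Matrix.one_apply_ne hk, mul_zero]

/-- The reindexing turns pairs (row, column) for each mode into pairs of modes for rows and for
columns, the order in which a two-mode trace is summed. -/
lemma hasSum_pairing_mul {u v : ℕ × ℕ → ℂ} (hu : Summable fun p => ‖u p‖)
    (hv : Summable fun p => ‖v p‖) :
    HasSum (fun x : (ℕ × ℕ) × (ℕ × ℕ) => u (x.1.1, x.2.1) * v (x.1.2, x.2.2))
      ((∑' p, u p) * ∑' p, v p) :=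
  (Equiv.prodProdProdComm ℕ ℕ ℕ ℕ).hasSum_iff.2
    (hu.of_norm.hasSum.mul hv.of_norm.hasSum (summable_mul_of_summable_norm hu hv))

section Tensor

variable {T : Type*} (s : Finset T) (w : T → ℂ) (A B : T → Matrix ℕ ℕ ℂ)

/-- A finite linear combination of product operators on two modes. -/
def tensorSum : Matrix (ℕ × ℕ) (ℕ × ℕ) ℂ :=
  fun i j => ∑ t ∈ s, w t * (A t i.1 j.1 * B t i.2 j.2)

variable {s w A B} {M N : Matrix ℕ ℕ ℂ}
  (hA : ∀ t ∈ s, AbsSummable (A t)) (hB : ∀ t ∈ s, AbsSummable (B t))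
  (hM : ∀ m n, ‖M m n‖ ≤ 1) (hN : ∀ m n, ‖N m n‖ ≤ 1)

include hA hB hM hN in
lemma opTrace_tensorSum_kronecker :
    opTrace (opMul (tensorSum s w A B) (M ⊗ₖ N)) =
      ∑ t ∈ s, w t * (pairing (A t) M * pairing (B t) N) := by
  have h : HasSum (fun x : (ℕ × ℕ) × (ℕ × ℕ) =>
      tensorSum s w A B x.1 x.2 * (M ⊗ₖ N) x.2 x.1)
      (∑ t ∈ s, w t * (pairing (A t) M * pairing (B t) N)) := by
    have h1 : ∀ t ∈ s, HasSum (fun x : (ℕ × ℕ) × (ℕ × ℕ) =>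
        w t * ((A t x.1.1 x.2.1 * M x.2.1 x.1.1) * (B t x.1.2 x.2.2 * N x.2.2 x.1.2)))
        (w t * (pairing (A t) M * pairing (B t) N)) := by
      intro t ht
      have e1 := (hA t ht).summable_norm hM
      have e2 := (hB t ht).summable_norm hN
      exact (hasSum_pairing_mul e1 e2).mul_left (w t)
    refine (hasSum_sum h1).congr_fun fun x => ?_
    rw [tensorSum, Finset.sum_mul]
    refine Finset.sum_congr rfl fun t _ => ?_
    rw [Matrix.kroneckerMap_apply]
    ring
  rw [← h.tsum_eq, h.summable.tsum_prod]
  rfl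

include hA hB in
lemma opTrace_tensorSum :
    opTrace (tensorSum s w A B) = ∑ t ∈ s, w t * (pairing (A t) 1 * pairing (B t) 1) := by
  rw [← opTrace_tensorSum_kronecker hA hB norm_one_apply_le norm_one_apply_le,
    Matrix.one_kronecker_one, opMul_one]

include hA hM in
lemma opTrace_sum_smul (z : T → ℂ) :
    opTrace (opMul (fun i j => ∑ t ∈ s, w t * (A t i j * z t)) M) =
      ∑ t ∈ s, w t * (pairing (A t) M * z t) := by
  have h : HasSum (fun x : ℕ × ℕ => (∑ t ∈ s, w t * (A t x.1 x.2 * z t)) * M x.2 x.1)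
      (∑ t ∈ s, w t * (pairing (A t) M * z t)) := by
    refine (hasSum_sum fun t ht => ((((hA t ht).summable_norm hM).of_norm.hasSum.mul_right
      (z t)).mul_left (w t))).congr_fun fun x => ?_
    rw [Finset.sum_mul]
    refine Finset.sum_congr rfl fun t _ => ?_
    ring
  rw [← h.tsum_eq, h.summable.tsum_prod]
  rfl

include hA hB hM in
lemma opTrace_ptraceSnd_tensorSum :
    opTrace (opMul (ptraceSnd (tensorSum s w A B)) M) =
      ∑ t ∈ s, w t * (pairing (A t) M * pairing (B t) 1) := by
  rw [← opTrace_sum_smul hA hM]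
  congr 2
  ext i j
  exact (hasSum_sum fun t ht => (((hB t ht).hasSum_diag.mul_left (A t i j)).mul_left (w t))).tsum_eq

include hA hB hN in
lemma opTrace_ptraceFst_tensorSum :
    opTrace (opMul (ptraceFst (tensorSum s w A B)) N) =
      ∑ t ∈ s, w t * (pairing (A t) 1 * pairing (B t) N) := by
  have h := opTrace_sum_smul (w := w) hB hN fun t => pairing (A t) 1
  refine (Eq.trans ?_ h).trans (Finset.sum_congr rfl fun t _ => by ring)
  congr 2
  ext i j
  refine (hasSum_sum fun t ht =>
    (((hA t ht).hasSum_diag.mul_right (B t i j)).mul_left (w t))).tsum_eq.trans ?_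
  exact Finset.sum_congr rfl fun t _ => by ring

end Tensor

/-! ### Scaling -/

section Scaling

variable {ι κ : Type*} (c : ℂ)

lemma opTrace_smul (A : Matrix ι ι ℂ) : opTrace (c • A) = c * opTrace A := tsum_mul_left

lemma smul_opMul {μ : Type*} (A : Matrix ι κ ℂ) (B : Matrix κ μ ℂ) :
    opMul (c • A) B = c • opMul A B := by
  ext i j
  simp only [opMul, Matrix.smul_apply, smul_eq_mul, mul_assoc, tsum_mul_left]

lemma ptraceSnd_smul (A : Matrix (ι × κ) (ι × κ) ℂ) : ptraceSnd (c • A) = c • ptraceSnd A := by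
  ext i j
  simp only [ptraceSnd, Matrix.smul_apply, smul_eq_mul, tsum_mul_left]

lemma ptraceFst_smul (A : Matrix (ι × κ) (ι × κ) ℂ) : ptraceFst (c • A) = c • ptraceFst A := by
  ext i j
  simp only [ptraceFst, Matrix.smul_apply, smul_eq_mul, tsum_mul_left]

lemma loss_smul (r : ℝ) (σ : Matrix (ι × ℕ) (ι × ℕ) ℂ) : loss r (c • σ) = c • loss r σ := by
  ext ⟨i, k⟩ ⟨j, l⟩
  rw [Matrix.smul_apply, loss_apply, loss_apply, smul_eq_mul, ← tsum_mul_left]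
  refine tsum_congr fun p => ?_
  rw [Matrix.smul_apply, smul_eq_mul]
  ring

lemma condState_smul (Pi σA σB : Matrix (ℕ × ℕ) (ℕ × ℕ) ℂ) :
    condState Pi σA (c • σB) = c • condState Pi σA σB := by
  ext i j
  rw [Matrix.smul_apply, condState, condState, smul_eq_mul, ← tsum_mul_left]
  refine tsum_congr fun k => ?_
  rw [← tsum_mul_left]
  refine tsum_congr fun l => ?_
  rw [Matrix.smul_apply, smul_eq_mul]
  ring

variable {c}

lemma normalize_smul (hc : c ≠ 0) (A : Matrix ι ι ℂ) : normalize (c • A) = normalize A := by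
  rw [normalize, normalize, opTrace_smul, smul_smul, mul_inv_rev, mul_assoc, inv_mul_cancel₀ hc,
    mul_one]

/-- This allows the normalisation of Bob's heralded source, itself a quotient of quantities
vanishing with the gain, to be dropped before the limit. -/
lemma rhoOut_smul (hc : c ≠ 0) (g rt φc : ℝ) (f h : ℝ → ℂ) (ρB : Matrix (ℕ × ℕ) (ℕ × ℕ) ℂ) :
    rhoOut g rt φc f h (c • ρB) = rhoOut g rt φc f h ρB := by
  rw [rhoOut, rhoOut, loss_smul, condState_smul, normalize_smul hc]

end Scaling

/-! ### Alice's state -/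

/-- The block `⟨·,k|σ|·,l⟩` of a two-mode operator. -/
def block (σ : Matrix (ℕ × ℕ) (ℕ × ℕ) ℂ) (k l : ℕ) : Matrix ℕ ℕ ℂ := fun i j => σ (i, k) (j, l)

/-- The operator `∑ₚ uₚ |k+p⟩⟨l+p|`. -/
def band (k l : ℕ) (u : ℕ → ℂ) : Matrix ℕ ℕ ℂ :=
  fun i j => if k ≤ i ∧ j = l + (i - k) then u (i - k) else 0

lemma band_apply_add (k l : ℕ) (u : ℕ → ℂ) (p : ℕ) : band k l u (k + p) (l + p) = u p := by
  simp [band]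

lemma band_eq_zero {k l : ℕ} {u : ℕ → ℂ} {x : ℕ × ℕ}
    (hx : x ∉ Set.range fun p : ℕ => (k + p, l + p)) : band k l u x.1 x.2 = 0 := by
  refine if_neg fun h => hx ⟨x.1 - k, ?_⟩
  ext
  · simp only; omega
  · simp only; omega

lemma injective_add_pair (k l : ℕ) : Function.Injective fun p : ℕ => (k + p, l + p) := by
  intro a b h
  have := (Prod.mk.inj h).1
  omega

lemma absSummable_band {k l : ℕ} {u : ℕ → ℂ} (hu : Summable fun p => ‖u p‖) :
    AbsSummable (band k l u) := by
  rw [AbsSummable, ← (injective_add_pair k l).summable_iff]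
  · exact hu.congr fun p => by simp only [Function.comp, band_apply_add]
  · intro x hx
    rw [band_eq_zero hx, norm_zero]

lemma pairing_band {k l : ℕ} {u : ℕ → ℂ} {M : Matrix ℕ ℕ ℂ} {s : ℂ}
    (h : HasSum (fun p => u p * M (l + p) (k + p)) s) : pairing (band k l u) M = s := by
  refine HasSum.tsum_eq ?_
  rw [← (injective_add_pair k l).hasSum_iff]
  · exact h.congr_fun fun p => by simp only [Function.comp, band_apply_add]
  · intro x hx
    rw [band_eq_zero hx, zero_mul]

/-- The coefficients of the two-mode squeezed vacuum. -/
noncomputable def tmsvCoeff (g : ℝ) (n : ℕ) : ℂ := ((Real.tanh g ^ n / Real.cosh g : ℝ) : ℂ)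

/-- The photon number of `a₁` fixes how many photons entered the line, hence how many were lost, so
the loss sum has a single term. -/
lemma block_loss_tmsv (g r : ℝ) (k l : ℕ) :
    block (loss r (ketbra (tmsv g))) k l =
      band k l fun p =>
        lossAmp r k p * lossAmp r l p * (tmsvCoeff g (k + p) * tmsvCoeff g (l + p)) := by
  ext i j
  rw [block, loss_apply, tsum_eq_single (i - k)]
  · rw [band]
    by_cases hk : k ≤ i
    · by_cases hj : j = l + (i - k)
      · rw [if_pos ⟨hk, hj⟩]
        subst hj
        have : k + (i - k) = i := by omega
        simp only [ketbra, tmsv, this, if_true, Complex.conj_ofReal, tmsvCoeff]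
      · rw [if_neg (fun h => hj h.2)]
        simp [ketbra, tmsv, hj]
    · rw [if_neg (fun h => hk h.1)]
      have : i ≠ k + (i - k) := by omega
      simp [ketbra, tmsv, this]
  · intro p hp
    have : i ≠ k + p := by omega
    simp [ketbra, tmsv, this]

section Alice

variable {g r : ℝ} (hr : 0 ≤ r) (hr1 : r ≤ 1) (p : ℕ)
include hr

/-- The four coefficient families match the series `diagGen`, `offDiagGen` (and its conjugate) and
`diagGenDeriv` at `c = r tanh² g`: each lost photon costs a factor `r tanh² g`. -/
lemma aliceCoeff_zero_zero :
    lossAmp r 0 p * lossAmp r 0 p * (tmsvCoeff g (0 + p) * tmsvCoeff g (0 + p)) =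
      ((Real.cosh g : ℂ)⁻¹) ^ 2 * ((r * Real.tanh g ^ 2 : ℝ) : ℂ) ^ p := by
  rw [lossAmp_zero_mul hr, tmsvCoeff]
  push_cast
  rw [zero_add, mul_pow, ← pow_mul]
  field_simp
  ring

lemma aliceCoeff_zero_one :
    lossAmp r 0 p * lossAmp r 1 p * (tmsvCoeff g (0 + p) * tmsvCoeff g (1 + p)) =
      ((Real.cosh g : ℂ)⁻¹) ^ 2 * Real.tanh g * (Real.sqrt (1 - r) : ℂ) *
        (((r * Real.tanh g ^ 2 : ℝ) : ℂ) ^ p * sqrtNat (p + 1)) := by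
  rw [lossAmp_one, show lossAmp r 0 p * (sqrtNat (p + 1) * (Real.sqrt (1 - r) : ℂ) * lossAmp r 0 p)
    = sqrtNat (p + 1) * (Real.sqrt (1 - r) : ℂ) * (lossAmp r 0 p * lossAmp r 0 p) by ring,
    lossAmp_zero_mul hr, tmsvCoeff, tmsvCoeff]
  push_cast
  rw [zero_add, mul_pow (r : ℂ), ← pow_mul, pow_add]
  field_simp
  ring

lemma aliceCoeff_one_zero :
    lossAmp r 1 p * lossAmp r 0 p * (tmsvCoeff g (1 + p) * tmsvCoeff g (0 + p)) =
      ((Real.cosh g : ℂ)⁻¹) ^ 2 * Real.tanh g * (Real.sqrt (1 - r) : ℂ) *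
        (((r * Real.tanh g ^ 2 : ℝ) : ℂ) ^ p * sqrtNat (p + 1)) := by
  rw [← aliceCoeff_zero_one hr]
  ring

include hr1 in
lemma aliceCoeff_one_one :
    lossAmp r 1 p * lossAmp r 1 p * (tmsvCoeff g (1 + p) * tmsvCoeff g (1 + p)) =
      ((Real.cosh g : ℂ)⁻¹) ^ 2 * Real.tanh g ^ 2 * (1 - r) *
        ((p + 1) * ((r * Real.tanh g ^ 2 : ℝ) : ℂ) ^ p) := by
  have h1 : (Real.sqrt (1 - r) : ℂ) * Real.sqrt (1 - r) = 1 - r := by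
    rw [← Complex.ofReal_mul, Real.mul_self_sqrt (by linarith)]
    push_cast; rfl
  have h2 := sqrtNat_mul_self (p + 1)
  rw [lossAmp_one, show sqrtNat (p + 1) * (Real.sqrt (1 - r) : ℂ) * lossAmp r 0 p *
      (sqrtNat (p + 1) * (Real.sqrt (1 - r) : ℂ) * lossAmp r 0 p)
    = (sqrtNat (p + 1) * sqrtNat (p + 1)) * ((Real.sqrt (1 - r) : ℂ) * Real.sqrt (1 - r))
      * (lossAmp r 0 p * lossAmp r 0 p) by ring, h1, h2,
    lossAmp_zero_mul hr, tmsvCoeff]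
  push_cast
  rw [mul_pow (r : ℂ), ← pow_mul, pow_add]
  field_simp
  ring

end Alice

lemma tanh_sq_lt_one (g : ℝ) : Real.tanh g ^ 2 < 1 := by
  have h := Real.cosh_sq g
  rw [Real.tanh_eq_sinh_div_cosh, div_pow, div_lt_one (by have := Real.cosh_pos g; positivity)]
  linarith

lemma loss_mul_tanh_sq_lt_one {r : ℝ} (g : ℝ) (hr1 : r < 1) :
    r * Real.tanh g ^ 2 < 1 := by
  nlinarith [tanh_sq_lt_one g, sq_nonneg (Real.tanh g)]

section AlicePairing

variable {g r : ℝ} (hr : 0 ≤ r) (hr1 : r < 1)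
include hr hr1

lemma norm_loss_mul_tanh_sq_lt_one : ‖((r * Real.tanh g ^ 2 : ℝ) : ℂ)‖ < 1 := by
  rw [Complex.norm_real, Real.norm_of_nonneg (by positivity)]
  exact loss_mul_tanh_sq_lt_one g hr1

lemma absSummable_alice {k l : ℕ} (hk : k ≤ 1) (hl : l ≤ 1) :
    AbsSummable (block (loss r (ketbra (tmsv g))) k l) := by
  have hs := summable_succ_mul_pow (norm_nonneg _) (norm_loss_mul_tanh_sq_lt_one (g := g) hr hr1)
  have hs2 : ∀ c : ℂ, Summable fun p : ℕ =>
      ‖c * (((r * Real.tanh g ^ 2 : ℝ) : ℂ) ^ p * sqrtNat (p + 1))‖ := fun c =>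
    Summable.of_nonneg_of_le (fun _ => norm_nonneg _) (fun p => by
      rw [norm_mul, norm_mul, norm_pow, mul_comm (_ ^ p)]
      gcongr
      exact norm_sqrtNat_succ_le p) (hs.mul_left ‖c‖)
  rw [block_loss_tmsv]
  refine absSummable_band ?_
  interval_cases k <;> interval_cases l
  · simp only [aliceCoeff_zero_zero hr]
    refine ((summable_geometric_of_lt_one (norm_nonneg _)
      (norm_loss_mul_tanh_sq_lt_one (g := g) hr hr1)).mul_left
      ‖((Real.cosh g : ℂ)⁻¹) ^ 2‖).congr fun p => ?_
    rw [norm_mul, norm_pow _ p]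
  · simp only [aliceCoeff_zero_one hr]
    exact hs2 _
  · simp only [aliceCoeff_one_zero hr]
    exact hs2 _
  · simp only [aliceCoeff_one_one hr hr1.le]
    refine (hs.mul_left ‖((Real.cosh g : ℂ)⁻¹) ^ 2 * Real.tanh g ^ 2 * (1 - r)‖).congr
      fun p => ?_
    refine Eq.symm ((norm_mul _ _).trans (congrArg _ ((norm_mul _ _).trans ?_)))
    rw [norm_pow, ← Nat.cast_succ, Complex.norm_natCast, Nat.cast_succ]

variable {η : ℝ} (h0 : 0 ≤ η) (h1 : η ≤ 1) (δ : ℂ)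
include h0 h1

lemma pairing_alice_zero_zero :
    pairing (block (loss r (ketbra (tmsv g))) 0 0) (localNoClick η δ) =
      ((Real.cosh g : ℂ)⁻¹) ^ 2 * diagGen η δ ((r * Real.tanh g ^ 2 : ℝ) : ℂ) := by
  rw [block_loss_tmsv]
  refine pairing_band (((hasSum_diagGen h0 h1 δ
    (norm_loss_mul_tanh_sq_lt_one hr hr1)).mul_left _).congr_fun fun p => ?_)
  rw [aliceCoeff_zero_zero hr, zero_add, mul_assoc]

lemma pairing_alice_zero_one :
    pairing (block (loss r (ketbra (tmsv g))) 0 1) (localNoClick η δ) =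
      ((Real.cosh g : ℂ)⁻¹) ^ 2 * Real.tanh g * (Real.sqrt (1 - r) : ℂ) *
        offDiagGen η δ ((r * Real.tanh g ^ 2 : ℝ) : ℂ) := by
  rw [block_loss_tmsv]
  refine pairing_band (((hasSum_offDiagGen h0 h1 δ
    (norm_loss_mul_tanh_sq_lt_one hr hr1)).mul_left _).congr_fun fun p => ?_)
  rw [aliceCoeff_zero_one hr, zero_add, add_comm 1 p, mul_assoc]

lemma pairing_alice_one_zero :
    pairing (block (loss r (ketbra (tmsv g))) 1 0) (localNoClick η δ) =
      ((Real.cosh g : ℂ)⁻¹) ^ 2 * Real.tanh g * (Real.sqrt (1 - r) : ℂ) *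
        conj (offDiagGen η δ (conj ((r * Real.tanh g ^ 2 : ℝ) : ℂ))) := by
  rw [block_loss_tmsv]
  refine pairing_band (((hasSum_offDiagGen_conj h0 h1 δ
    (norm_loss_mul_tanh_sq_lt_one hr hr1)).mul_left _).congr_fun fun p => ?_)
  rw [aliceCoeff_one_zero hr, zero_add, add_comm 1 p, mul_assoc]

lemma pairing_alice_one_one :
    pairing (block (loss r (ketbra (tmsv g))) 1 1) (localNoClick η δ) =
      ((Real.cosh g : ℂ)⁻¹) ^ 2 * Real.tanh g ^ 2 * (1 - r) *
        diagGenDeriv η δ ((r * Real.tanh g ^ 2 : ℝ) : ℂ) := by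
  have hT := (hasSum_nat_add_iff' 1).2 (hasSum_diagGenDeriv h0 h1 δ
    (norm_loss_mul_tanh_sq_lt_one (g := g) hr hr1))
  simp only [Finset.range_one, Finset.sum_singleton, Nat.cast_zero, zero_mul, sub_zero,
      Nat.add_sub_cancel] at hT
  rw [block_loss_tmsv]
  refine pairing_band ((hT.mul_left _).congr_fun fun p => ?_)
  rw [aliceCoeff_one_one hr hr1.le, add_comm 1 p, mul_assoc, Nat.cast_succ]

end AlicePairing

/-! ### Bob's state -/

/-- The state of `(b₁, b₂)` behind a beam splitter with output amplitudes `a`, `b` when `n` photons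
enter with probability `Pₙ`. -/
noncomputable def splitState (a b : ℂ) (P : ℕ → ℂ) : Matrix (ℕ × ℕ) (ℕ × ℕ) ℂ := fun i j =>
  if i.1 + i.2 = j.1 + j.2 then
    P (i.1 + i.2) * (splitAmp a b i.1 i.2 * conj (splitAmp a b j.1 j.2)) else 0

/-- The contribution of `p` lost photons to the matrix element `⟨i,k| · |j,l⟩` of the state
`splitState a b P` behind a lossy line. -/
noncomputable def bobTerm (r : ℝ) (a b : ℂ) (P : ℕ → ℂ) (k l : ℕ) (x : (ℕ × ℕ) × ℕ) : ℂ :=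
  lossAmp r k x.2 * lossAmp r l x.2 * splitState a b P (x.1.1, k + x.2) (x.1.2, l + x.2)

/-- A summable majorant on triples of photon numbers. -/
noncomputable def geomBound (x : (ℕ × ℕ) × ℕ) : ℝ :=
  (1 / 2) ^ x.1.1 * (1 / 2) ^ x.1.2 * (1 / 2) ^ x.2

lemma summable_half_mul_half :
    Summable fun x : ℕ × ℕ => (1 / 2 : ℝ) ^ x.1 * (1 / 2) ^ x.2 :=
  summable_geometric_two.mul_of_nonneg summable_geometric_two
    (fun _ => by positivity) (fun _ => by positivity)

lemma summable_geomBound : Summable geomBound :=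
  summable_half_mul_half.mul_of_nonneg summable_geometric_two
    (fun _ => by positivity) (fun _ => by positivity)

section Bob

variable {r : ℝ} {a b : ℂ} {P : ℕ → ℂ} {K : ℝ}
  (hr : 0 ≤ r) (hr1 : r ≤ 1) (ha : ‖a‖ ≤ 1) (hb : ‖b‖ ≤ 1) (hP : ∀ n, ‖P n‖ ≤ K * (1 / 64) ^ n)
  (k l : ℕ)
include hr hr1 ha hb hP

/-- With `n = i + k + p = j + l + p`, four amplitudes cost `2 ^ n` each against `64 = 2 ^ 6`. Two
factors `(1/2) ^ n` remain: one dominates in `i`, the other in `j + p`. -/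
lemma norm_bobTerm_le (x : (ℕ × ℕ) × ℕ) : ‖bobTerm r a b P k l x‖ ≤ K * geomBound x := by
  obtain ⟨⟨i, j⟩, p⟩ := x
  have hK : 0 ≤ K := by simpa using (norm_nonneg _).trans (hP 0)
  rw [bobTerm, splitState]
  dsimp only
  split_ifs with h
  · obtain ⟨n, hn⟩ : ∃ n, n = i + (k + p) := ⟨_, rfl⟩
    have hn2 : j + (l + p) = n := by omega
    rw [norm_mul, norm_mul, norm_mul, norm_mul, RCLike.norm_conj]
    have e1 := norm_splitAmp_le ha hb i (k + p)
    have e2 := norm_splitAmp_le ha hb j (l + p)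
    have e3 : ‖lossAmp r k p‖ ≤ 2 ^ n := (norm_lossAmp_le hr hr1 k p).trans
      (pow_le_pow_right₀ (by norm_num) (by omega))
    have e4 : ‖lossAmp r l p‖ ≤ 2 ^ n := (norm_lossAmp_le hr hr1 l p).trans
      (pow_le_pow_right₀ (by norm_num) (by omega))
    have e5 := hP (i + (k + p))
    rw [← hn] at e1 e5 ⊢
    rw [hn2] at e2
    calc _ ≤ (2 : ℝ) ^ n * 2 ^ n * (K * (1 / 64) ^ n * (2 ^ n * 2 ^ n)) := by gcongr
      _ = K * ((1 / 2) ^ n * (1 / 2) ^ n) := by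
        rw [show (1 / 64 : ℝ) = (1 / 2) ^ 6 by norm_num, ← pow_mul]
        have : (2 : ℝ) ^ n * (1 / 2) ^ n = 1 := by rw [← mul_pow]; norm_num
        rw [show 6 * n = n + n + n + n + n + n by ring]
        simp only [pow_add]
        linear_combination K * ((1 / 2) ^ n * (1 / 2) ^ n) * (
          ((2 : ℝ) ^ n * (1 / 2) ^ n) ^ 3 + ((2 : ℝ) ^ n * (1 / 2) ^ n) ^ 2
          + ((2 : ℝ) ^ n * (1 / 2) ^ n) + 1) * this
      _ ≤ K * geomBound ((i, j), p) := by
        rw [geomBound]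
        dsimp only
        rw [mul_assoc ((1 / 2 : ℝ) ^ i)]
        refine mul_le_mul_of_nonneg_left ?_ hK
        refine mul_le_mul (pow_le_pow_of_le_one (by norm_num) (by norm_num) (by omega)) ?_
          (by positivity) (by positivity)
        rw [← pow_add]
        exact pow_le_pow_of_le_one (by norm_num) (by norm_num) (by omega)
  · rw [mul_zero, norm_zero, geomBound]
    positivity

lemma absSummable_bob : AbsSummable (block (loss r (splitState a b P)) k l) := by
  refine Summable.of_nonneg_of_le (fun _ => norm_nonneg _) (fun x => ?_)
    (summable_half_mul_half.mul_left (K * 2))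
  rw [block, loss_apply]
  refine tsum_of_norm_bounded ?_ fun p => norm_bobTerm_le hr hr1 ha hb hP k l (x, p)
  have h := hasSum_geometric_two.mul_left (K * ((1 / 2 : ℝ) ^ x.1 * (1 / 2) ^ x.2))
  rw [show K * 2 * ((1 / 2 : ℝ) ^ x.1 * (1 / 2) ^ x.2)
    = K * ((1 / 2 : ℝ) ^ x.1 * (1 / 2) ^ x.2) * 2 by ring]
  refine h.congr_fun fun p => ?_
  rw [geomBound]
  ring

variable {N : Matrix ℕ ℕ ℂ} (hN : ∀ m n, ‖N m n‖ ≤ 1)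
include hN

lemma norm_bobTerm_mul_le (x : (ℕ × ℕ) × ℕ) :
    ‖bobTerm r a b P k l x * N x.1.2 x.1.1‖ ≤ K * geomBound x := by
  rw [norm_mul]
  exact (mul_le_of_le_one_right (norm_nonneg _) (hN _ _)).trans
    (norm_bobTerm_le hr hr1 ha hb hP k l x)

/-- Trace and loss sums merge into one absolutely convergent sum over triples, so that dominated
convergence is needed only once. -/
lemma pairing_bob : pairing (block (loss r (splitState a b P)) k l) N =
    ∑' x : (ℕ × ℕ) × ℕ, bobTerm r a b P k l x * N x.1.2 x.1.1 := by
  have h : Summable fun x : (ℕ × ℕ) × ℕ => bobTerm r a b P k l x * N x.1.2 x.1.1 :=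
    Summable.of_norm_bounded (summable_geomBound.mul_left K)
      (norm_bobTerm_mul_le hr hr1 ha hb hP k l hN)
  rw [h.tsum_prod, pairing]
  refine tsum_congr fun x => ?_
  rw [block, loss_apply, ← tsum_mul_right]
  rfl

end Bob

/-- The single-photon distribution. -/
noncomputable def onePhoton : ℕ → ℂ := fun n => if n = 1 then 1 else 0

lemma norm_onePhoton_le (n : ℕ) : ‖onePhoton n‖ ≤ 64 * (1 / 64) ^ n := by
  rw [onePhoton]
  split_ifs with h
  · subst h; norm_num
  · rw [norm_zero]; positivity

/-- Convergence of the number distribution to a single photon, under a geometric bound, gives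
convergence of Bob's amplitudes. -/
lemma tendsto_pairing_bob {r : ℝ} {a b : ℂ} {K : ℝ} {N : Matrix ℕ ℕ ℂ} {F : Filter ℝ}
    {P : ℝ → ℕ → ℂ} (hr : 0 ≤ r) (hr1 : r ≤ 1) (ha : ‖a‖ ≤ 1) (hb : ‖b‖ ≤ 1)
    (hP : ∀ᶠ y in F, ∀ n, ‖P y n‖ ≤ K * (1 / 64) ^ n)
    (hlim : ∀ n, Tendsto (fun y => P y n) F (𝓝 (onePhoton n)))
    (hN : ∀ m n, ‖N m n‖ ≤ 1) (k l : ℕ) :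
    Tendsto (fun y => pairing (block (loss r (splitState a b (P y))) k l) N) F
      (𝓝 (pairing (block (loss r (splitState a b onePhoton)) k l) N)) := by
  rw [pairing_bob hr hr1 ha hb norm_onePhoton_le k l hN]
  have h := tendsto_tsum_of_dominated_convergence (𝓕 := F)
    (f := fun y (x : (ℕ × ℕ) × ℕ) => bobTerm r a b (P y) k l x * N x.1.2 x.1.1)
    (g := fun x => bobTerm r a b onePhoton k l x * N x.1.2 x.1.1)
    (summable_geomBound.mul_left K) (fun x => ?_) ?_
  · refine h.congr' ?_
    filter_upwards [hP] with y hy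
    rw [pairing_bob hr hr1 ha hb hy k l hN]
  · refine Tendsto.mul_const _ ?_
    simp only [bobTerm, splitState]
    split_ifs
    · exact ((hlim _).mul_const _).const_mul _
    · exact tendsto_const_nhds
  · filter_upwards [hP] with y hy
    exact norm_bobTerm_mul_le hr hr1 ha hb hy k l hN

lemma bobTerm_onePhoton_eq_zero {r : ℝ} {a b : ℂ} {k l i j p : ℕ}
    (h : ¬ (i + (k + p) = 1 ∧ j + (l + p) = 1)) :
    bobTerm r a b onePhoton k l ((i, j), p) = 0 := by
  simp only [bobTerm, splitState, onePhoton]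
  split_ifs with h1 h2
  · exact absurd ⟨h2, h1 ▸ h2⟩ h
  · ring
  · ring

/-! ### Bob's blocks for a single photon -/

section OnePhoton

variable {r : ℝ} {a b : ℂ} (hr : 0 ≤ r) (hr1 : r ≤ 1) (ha : ‖a‖ ≤ 1) (hb : ‖b‖ ≤ 1)
  {N : Matrix ℕ ℕ ℂ} (hN : ∀ m n, ‖N m n‖ ≤ 1)
include hr hr1 ha hb hN

/-- If no photon reaches Charlie from Bob, the photon is either in `b₁` or lost; these are the two
terms. -/
lemma pairing_onePhoton_zero_zero :
    pairing (block (loss r (splitState a b onePhoton)) 0 0) N =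
      a * conj a * N 1 1 + r * (b * conj b) * N 0 0 := by
  rw [pairing_bob hr hr1 ha hb norm_onePhoton_le 0 0 hN,
    tsum_eq_sum (s := {((1, 1), 0), ((0, 0), 1)}), Finset.sum_pair (by simp)]
  · simp [bobTerm, splitState, onePhoton, splitAmp_zero_left, splitAmp_one_left,
      lossAmp_zero_mul hr]
  · rintro ⟨⟨i, j⟩, p⟩ hx
    rw [bobTerm_onePhoton_eq_zero, zero_mul]
    rintro ⟨h1, h2⟩
    simp only [Finset.mem_insert, Finset.mem_singleton, Prod.mk.injEq] at hx
    omega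

lemma pairing_onePhoton_one_one :
    pairing (block (loss r (splitState a b onePhoton)) 1 1) N =
      (1 - r) * (b * conj b) * N 0 0 := by
  have e : (Real.sqrt (1 - r) : ℂ) * Real.sqrt (1 - r) = 1 - r := by
    rw [← Complex.ofReal_mul, Real.mul_self_sqrt (by linarith)]
    push_cast; rfl
  rw [pairing_bob hr hr1 ha hb norm_onePhoton_le 1 1 hN,
    tsum_eq_single ((0, 0), 0)]
  · simp [bobTerm, splitState, onePhoton, splitAmp_zero_left, splitAmp_one_left, lossAmp, e]
  · rintro ⟨⟨i, j⟩, p⟩ hx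
    rw [bobTerm_onePhoton_eq_zero, zero_mul]
    rintro ⟨h1, h2⟩
    simp only [ne_eq, Prod.mk.injEq] at hx
    omega

lemma pairing_onePhoton_one_zero :
    pairing (block (loss r (splitState a b onePhoton)) 1 0) N =
      Real.sqrt (1 - r) * (b * conj a) * N 1 0 := by
  rw [pairing_bob hr hr1 ha hb norm_onePhoton_le 1 0 hN,
    tsum_eq_single ((0, 1), 0)]
  · simp [bobTerm, splitState, onePhoton, splitAmp_zero_left, splitAmp_one_left, lossAmp]
  · rintro ⟨⟨i, j⟩, p⟩ hx
    rw [bobTerm_onePhoton_eq_zero, zero_mul]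
    rintro ⟨h1, h2⟩
    simp only [ne_eq, Prod.mk.injEq] at hx
    omega

lemma pairing_onePhoton_zero_one :
    pairing (block (loss r (splitState a b onePhoton)) 0 1) N =
      Real.sqrt (1 - r) * (a * conj b) * N 0 1 := by
  rw [pairing_bob hr hr1 ha hb norm_onePhoton_le 0 1 hN,
    tsum_eq_single ((1, 0), 0)]
  · simp [bobTerm, splitState, onePhoton, splitAmp_zero_left, splitAmp_one_left, lossAmp]
  · rintro ⟨⟨i, j⟩, p⟩ hx
    rw [bobTerm_onePhoton_eq_zero, zero_mul]
    rintro ⟨h1, h2⟩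
    simp only [ne_eq, Prod.mk.injEq] at hx
    omega

end OnePhoton

/-! ### Charlie's measurement -/

/-- The photon numbers of `(a₂, b₂)` compatible with one detected photon. -/
def singlePhotonModes : Finset (ℕ × ℕ) := {(0, 1), (1, 0)}

lemma charlieBra_eq_zero {tc φc : ℝ} {f h : ℝ → ℂ} {ω : ℝ} {k : ℕ × ℕ}
    (hk : k ∉ singlePhotonModes) : charlieBra tc φc f h ω k = 0 := by
  simp only [singlePhotonModes, Finset.mem_insert, Finset.mem_singleton, not_or] at hk
  unfold charlieBra
  split
  · exact absurd rfl hk.1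
  · exact absurd rfl hk.2
  · rfl

lemma condState_charlie (tc φc : ℝ) (f h : ℝ → ℂ) (σA σB : Matrix (ℕ × ℕ) (ℕ × ℕ) ℂ) :
    condState (charlie tc φc f h) σA σB =
      tensorSum (singlePhotonModes ×ˢ singlePhotonModes) (fun t => charlie tc φc f h t.2 t.1)
        (fun t => block σA t.1.1 t.2.1) (fun t => block σB t.1.2 t.2.2) := by
  ext i j
  rw [tensorSum, Finset.sum_product, condState, tsum_eq_sum (s := singlePhotonModes)]
  · refine Finset.sum_congr rfl fun k _ => ?_
    rw [tsum_eq_sum (s := singlePhotonModes)]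
    · rfl
    · intro l hl
      simp [charlie, charlieBra_eq_zero hl]
  · intro k hk
    simp [charlie, charlieBra_eq_zero hk]

lemma sqrt_half_mul_self : (Real.sqrt (1 / 2) : ℂ) * Real.sqrt (1 / 2) = 1 / 2 := by
  rw [← Complex.ofReal_mul, Real.mul_self_sqrt (by norm_num)]
  norm_num

lemma integral_conj_mul_self {f : ℝ → ℂ} (hf : ∫ ω, ‖f ω‖ ^ 2 = 1) :
    ∫ ω, conj (f ω) * f ω = 1 := by
  have e : ∀ ω, conj (f ω) * f ω = ((‖f ω‖ ^ 2 : ℝ) : ℂ) := fun ω => by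
    rw [mul_comm, mul_conj_eq_ofReal]
  simp only [e]
  rw [integral_complex_ofReal, hf, Complex.ofReal_one]

section Charlie

variable {f h : ℝ → ℂ} (φc : ℝ)

lemma conj_exp_I_mul (φ : ℝ) :
    conj (Complex.exp (Complex.I * φ)) = Complex.exp (-(Complex.I * φ)) := by
  rw [← Complex.exp_conj]
  simp

lemma conj_exp_neg_I_mul (φ : ℝ) :
    conj (Complex.exp (-(Complex.I * φ))) = Complex.exp (Complex.I * φ) := by
  rw [← conj_exp_I_mul, Complex.conj_conj]

lemma exp_I_mul_mul_exp_neg (φ : ℝ) :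
    Complex.exp (Complex.I * φ) * Complex.exp (-(Complex.I * φ)) = 1 := by
  rw [← Complex.exp_add, add_neg_cancel, Complex.exp_zero]

lemma charlie_snd_snd (hh : ∫ ω, ‖h ω‖ ^ 2 = 1) :
    charlie (1 / 2) φc f h (0, 1) (0, 1) = 1 / 2 := by
  have e : ∀ ω, conj (charlieBra (1 / 2) φc f h ω (0, 1)) * charlieBra (1 / 2) φc f h ω (0, 1) =
      1 / 2 * (conj (h ω) * h ω) := fun ω => by
    simp only [charlieBra, map_mul, Complex.conj_ofReal]
    linear_combination conj (h ω) * h ω * sqrt_half_mul_self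
  simp only [charlie, e]
  rw [integral_const_mul, integral_conj_mul_self hh, mul_one]

lemma charlie_fst_fst (hf : ∫ ω, ‖f ω‖ ^ 2 = 1) :
    charlie (1 / 2) φc f h (1, 0) (1, 0) = 1 / 2 := by
  have e : ∀ ω, conj (charlieBra (1 / 2) φc f h ω (1, 0)) * charlieBra (1 / 2) φc f h ω (1, 0) =
      1 / 2 * (conj (f ω) * f ω) := fun ω => by
    simp only [charlieBra, map_mul, Complex.conj_ofReal, conj_exp_neg_I_mul,
      show (1 : ℝ) - 1 / 2 = 1 / 2 by norm_num]
    linear_combination conj (f ω) * f ω * sqrt_half_mul_self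
      + conj (f ω) * f ω * Real.sqrt (1 / 2) * Real.sqrt (1 / 2) * exp_I_mul_mul_exp_neg φc
  simp only [charlie, e]
  rw [integral_const_mul, integral_conj_mul_self hf, mul_one]

/-- Only the off-diagonal entries see the overlap of the spectra, so the visibility enters through
the interference term alone. -/
lemma charlie_fst_snd :
    charlie (1 / 2) φc f h (1, 0) (0, 1) =
      1 / 2 * Complex.exp (Complex.I * φc) * ∫ ω, conj (f ω) * h ω := by
  have e : ∀ ω, conj (charlieBra (1 / 2) φc f h ω (1, 0)) * charlieBra (1 / 2) φc f h ω (0, 1) =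
      1 / 2 * Complex.exp (Complex.I * φc) * (conj (f ω) * h ω) := fun ω => by
    simp only [charlieBra, map_mul, Complex.conj_ofReal, conj_exp_neg_I_mul,
      show (1 : ℝ) - 1 / 2 = 1 / 2 by norm_num]
    linear_combination Complex.exp (Complex.I * φc) * conj (f ω) * h ω * sqrt_half_mul_self
  simp only [charlie, e]
  rw [integral_const_mul]

lemma charlie_snd_fst :
    charlie (1 / 2) φc f h (0, 1) (1, 0) =
      1 / 2 * Complex.exp (-(Complex.I * φc)) * conj (∫ ω, conj (f ω) * h ω) := by
  have e : ∀ ω, conj (charlieBra (1 / 2) φc f h ω (0, 1)) * charlieBra (1 / 2) φc f h ω (1, 0) =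
      1 / 2 * Complex.exp (-(Complex.I * φc)) * conj (conj (f ω) * h ω) := fun ω => by
    simp only [charlieBra, map_mul, Complex.conj_ofReal, Complex.conj_conj,
      show (1 : ℝ) - 1 / 2 = 1 / 2 by norm_num]
    linear_combination Complex.exp (-(Complex.I * φc)) * f ω * conj (h ω) * sqrt_half_mul_self
  simp only [charlie, e]
  rw [integral_const_mul, integral_conj]

end Charlie

/-! ### Probabilities of the heralded state -/

/-- The unnormalised expectation value of `M ⊗ N` in the state heralded by Charlie. -/
noncomputable def heraldedTrace (g rt φc : ℝ) (f h : ℝ → ℂ) (ρB : Matrix (ℕ × ℕ) (ℕ × ℕ) ℂ)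
    (M N : Matrix ℕ ℕ ℂ) : ℂ :=
  ∑ t ∈ singlePhotonModes ×ˢ singlePhotonModes, charlie (1 / 2) φc f h t.2 t.1 *
    (pairing (block (loss rt (ketbra (tmsv g))) t.1.1 t.2.1) M *
      pairing (block (loss rt ρB) t.1.2 t.2.2) N)

section Prob

variable {rt : ℝ} {a b : ℂ} {P : ℕ → ℂ} {K : ℝ} (g φc : ℝ) (f h : ℝ → ℂ)
  (hr : 0 ≤ rt) (hr1 : rt < 1) (ha : ‖a‖ ≤ 1) (hb : ‖b‖ ≤ 1)
  (hP : ∀ n, ‖P n‖ ≤ K * (1 / 64) ^ n) {η : ℝ} (h0 : 0 ≤ η) (h1 : η ≤ 1) (α β : ℂ)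
include hr hr1 ha hb hP

omit ha hb hP in
lemma absSummable_alice_mode : ∀ t ∈ singlePhotonModes ×ˢ singlePhotonModes,
    AbsSummable (block (loss rt (ketbra (tmsv g))) t.1.1 t.2.1) := by
  intro t ht
  simp only [singlePhotonModes, Finset.mem_product, Finset.mem_insert,
    Finset.mem_singleton] at ht
  refine absSummable_alice hr hr1 ?_ ?_
  · rcases ht.1 with e | e <;> simp [e]
  · rcases ht.2 with e | e <;> simp [e]

lemma opTrace_condState : opTrace (condState (charlie (1 / 2) φc f h)
      (loss rt (ketbra (tmsv g))) (loss rt (splitState a b P))) =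
    heraldedTrace g rt φc f h (splitState a b P) 1 1 := by
  rw [condState_charlie]
  exact opTrace_tensorSum (absSummable_alice_mode g hr hr1)
    (fun t _ => absSummable_bob hr hr1.le ha hb hP t.1.2 t.2.2)

include h0 h1

lemma probA_rhoOut : probA η α (rhoOut g rt φc f h (splitState a b P)) =
    (heraldedTrace g rt φc f h (splitState a b P) 1 1)⁻¹ *
      heraldedTrace g rt φc f h (splitState a b P) (localNoClick η α) 1 := by
  rw [probA, rhoOut, normalize, ptraceSnd_smul, smul_opMul, opTrace_smul,
    opTrace_condState g φc f h hr hr1 ha hb hP, condState_charlie]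
  congr 1
  exact opTrace_ptraceSnd_tensorSum (absSummable_alice_mode g hr hr1)
    (fun t _ => absSummable_bob hr hr1.le ha hb hP t.1.2 t.2.2) (norm_localNoClick_le h0 h1 α)

lemma probB_rhoOut : probB η β (rhoOut g rt φc f h (splitState a b P)) =
    (heraldedTrace g rt φc f h (splitState a b P) 1 1)⁻¹ *
      heraldedTrace g rt φc f h (splitState a b P) 1 (localNoClick η β) := by
  rw [probB, rhoOut, normalize, ptraceFst_smul, smul_opMul, opTrace_smul,
    opTrace_condState g φc f h hr hr1 ha hb hP, condState_charlie]
  congr 1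
  exact opTrace_ptraceFst_tensorSum (absSummable_alice_mode g hr hr1)
    (fun t _ => absSummable_bob hr hr1.le ha hb hP t.1.2 t.2.2) (norm_localNoClick_le h0 h1 β)

lemma probAB_rhoOut : probAB η α β (rhoOut g rt φc f h (splitState a b P)) =
    (heraldedTrace g rt φc f h (splitState a b P) 1 1)⁻¹ *
      heraldedTrace g rt φc f h (splitState a b P) (localNoClick η α) (localNoClick η β) := by
  rw [probAB, rhoOut, normalize, smul_opMul, opTrace_smul,
    opTrace_condState g φc f h hr hr1 ha hb hP, condState_charlie]
  congr 1
  exact opTrace_tensorSum_kronecker (absSummable_alice_mode g hr hr1)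
    (fun t _ => absSummable_bob hr hr1.le ha hb hP t.1.2 t.2.2) (norm_localNoClick_le h0 h1 α)
    (norm_localNoClick_le h0 h1 β)

end Prob

/-! ### Limit and closed form of the heralded expectation value -/

lemma tendsto_heraldedTrace {rt : ℝ} {a b : ℂ} {K : ℝ} {F : Filter ℝ} {P : ℝ → ℕ → ℂ}
    (g φc : ℝ) (f h : ℝ → ℂ) (hr : 0 ≤ rt) (hr1 : rt ≤ 1) (ha : ‖a‖ ≤ 1) (hb : ‖b‖ ≤ 1)
    (hP : ∀ᶠ y in F, ∀ n, ‖P y n‖ ≤ K * (1 / 64) ^ n)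
    (hlim : ∀ n, Tendsto (fun y => P y n) F (𝓝 (onePhoton n)))
    (M : Matrix ℕ ℕ ℂ) {N : Matrix ℕ ℕ ℂ} (hN : ∀ m n, ‖N m n‖ ≤ 1) :
    Tendsto (fun y => heraldedTrace g rt φc f h (splitState a b (P y)) M N) F
      (𝓝 (heraldedTrace g rt φc f h (splitState a b onePhoton) M N)) :=
  tendsto_finsetSum _ fun _ _ => Tendsto.const_mul _ (Tendsto.const_mul _
    (tendsto_pairing_bob hr hr1 ha hb hP hlim hN _ _))

lemma localNoClick_one_one {η : ℝ} (h0 : 0 ≤ η) (h1 : η ≤ 1) (δ : ℂ) :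
    localNoClick η δ 1 1 =
      (1 - η + η ^ 2 * (δ * conj δ)) * localNoClick η δ 0 0 := by
  have h := localNoClick_row h0 h1 δ 0 1
  have h2 := localNoClick_col h0 h1 δ 0 0
  simp only [zero_add, sqrtNat_one, one_mul, Nat.sub_self, sqrtNat_zero, mul_zero, zero_mul,
    add_zero, mul_one] at h h2
  rw [h, h2]
  ring

lemma localNoClick_one_zero {η : ℝ} (h0 : 0 ≤ η) (h1 : η ≤ 1) (δ : ℂ) :
    localNoClick η δ 1 0 = η * δ * localNoClick η δ 0 0 := by
  have h := localNoClick_row h0 h1 δ 0 0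
  simpa using h

lemma localNoClick_zero_one {η : ℝ} (h0 : 0 ≤ η) (h1 : η ≤ 1) (δ : ℂ) :
    localNoClick η δ 0 1 = η * conj δ * localNoClick η δ 0 0 := by
  have h := localNoClick_col h0 h1 δ 0 0
  simpa using h

lemma ofReal_sqrt_mul_self {x : ℝ} (hx : 0 ≤ x) : (Real.sqrt x : ℂ) * Real.sqrt x = x := by
  rw [← Complex.ofReal_mul, Real.mul_self_sqrt hx]

lemma norm_ofReal_sqrt_le_one {x : ℝ} (hx : x ≤ 1) : ‖(Real.sqrt x : ℂ)‖ ≤ 1 := by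
  rw [Complex.norm_real, Real.norm_of_nonneg (Real.sqrt_nonneg _)]
  exact Real.sqrt_le_one.2 hx

lemma norm_bobAmp_le {ts : ℝ} (φs : ℝ) (hts : 0 ≤ ts) :
    ‖Complex.exp (Complex.I * φs) * Real.sqrt (1 - ts)‖ ≤ 1 := by
  rw [norm_mul, Complex.norm_exp_I_mul_ofReal, one_mul]
  exact norm_ofReal_sqrt_le_one (by linarith)

/-- The closed form of `heraldedTrace` for an ideal single photon, as a function of the detector
efficiencies `ηa`, `ηb` and the squared displacements `x`, `y`. -/
noncomputable def heraldedValue (g rt ts C J ηa ηb x y : ℝ) : ℝ :=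
  1 / 2 * (Real.cosh g)⁻¹ ^ 2 * (1 - rt) *
    (Real.exp (-((1 - C) * ηa * x / (1 - C * (1 - ηa)))) / (1 - C * (1 - ηa)) ^ 2 *
      Real.exp (-(ηb * y))) *
    (ts * (1 + C * ηa ^ 2 * x / (1 - C * (1 - ηa)))
      + (1 - ts) * Real.tanh g ^ 2 * (1 - ηa + ηa ^ 2 * x / (1 - C * (1 - ηa)))
        * (1 - ηb + ηb ^ 2 * y)
      + 2 * (ηa * ηb) * Real.tanh g * Real.sqrt (ts * (1 - ts)) * J)

/-- Independent efficiencies let one formula serve for the norm, both marginals and the joint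
probability, since efficiency 0 gives the identity. The weight `ts` collects two events: Bob's
photon is detected, or it is lost and Alice's is detected. -/
lemma heraldedTrace_onePhoton {g rt ts φs φc ηa ηb : ℝ} {α β : ℂ} {f h : ℝ → ℂ}
    (hr : 0 ≤ rt) (hr1 : rt < 1) (hts : 0 ≤ ts) (hts1 : ts ≤ 1)
    (hηa0 : 0 ≤ ηa) (hηa1 : ηa ≤ 1) (hηb0 : 0 ≤ ηb) (hηb1 : ηb ≤ 1)
    (hf : ∫ ω, ‖f ω‖ ^ 2 = 1) (hh : ∫ ω, ‖h ω‖ ^ 2 = 1) :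
    heraldedTrace g rt φc f h
        (splitState (Complex.exp (Complex.I * φs) * Real.sqrt (1 - ts)) (Real.sqrt ts) onePhoton)
        (localNoClick ηa α) (localNoClick ηb β) =
      (heraldedValue g rt ts (rt * Real.tanh g ^ 2)
        (Complex.exp (Complex.I * (φc - φs)) * ((∫ ω, conj (f ω) * h ω) * α * β)).re
        ηa ηb (‖α‖ ^ 2) (‖β‖ ^ 2) : ℂ) := by
  have hC := norm_loss_mul_tanh_sq_lt_one (g := g) hr hr1
  have hD : (1 - (1 - (ηa : ℂ)) * ((rt * Real.tanh g ^ 2 : ℝ) : ℂ)) ≠ 0 :=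
    one_sub_mul_ne_zero hηa0 hηa1 hC
  have ha := norm_bobAmp_le φs hts
  have hb := norm_ofReal_sqrt_le_one hts1
  have hN := norm_localNoClick_le hηb0 hηb1 β
  have hα := mul_conj_eq_ofReal α
  have hβ := mul_conj_eq_ofReal β
  have hJ : (((Complex.exp (Complex.I * (φc - φs)) *
      ((∫ ω, conj (f ω) * h ω) * α * β)).re : ℝ) : ℂ) =
      (Complex.exp (Complex.I * φc) * Complex.exp (-(Complex.I * φs)) *
        ((∫ ω, conj (f ω) * h ω) * α * β) +
      Complex.exp (-(Complex.I * φc)) * Complex.exp (Complex.I * φs) *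
        (conj (∫ ω, conj (f ω) * h ω) * conj α * conj β)) / 2 := by
    rw [Complex.re_eq_add_conj, mul_sub, sub_eq_add_neg, Complex.exp_add]
    simp only [map_mul, conj_exp_I_mul, conj_exp_neg_I_mul]
  have hS := diagGen_eq hηa0 hηa1 α hC
  have hE := localNoClick_zero_zero hηb0 hηb1 β
  have hA10 := pairing_alice_one_zero (g := g) hr hr1 hηa0 hηa1 α
  rw [conj_offDiagGen_eq hηa0 hηa1 α hC] at hA10
  simp only [heraldedTrace, singlePhotonModes, Finset.sum_product]
  rw [Finset.sum_pair (by simp), Finset.sum_pair (by simp), Finset.sum_pair (by simp)]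
  simp only [pairing_alice_zero_zero hr hr1 hηa0 hηa1, pairing_alice_zero_one hr hr1 hηa0 hηa1,
    hA10, pairing_alice_one_one hr hr1 hηa0 hηa1,
    pairing_onePhoton_zero_zero hr hr1.le ha hb hN, pairing_onePhoton_zero_one hr hr1.le ha hb hN,
    pairing_onePhoton_one_zero hr hr1.le ha hb hN, pairing_onePhoton_one_one hr hr1.le ha hb hN,
    charlie_snd_snd φc hh, charlie_fst_fst φc hf, charlie_fst_snd, charlie_snd_fst,
    localNoClick_one_one hηb0 hηb1, localNoClick_one_zero hηb0 hηb1,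
    localNoClick_zero_one hηb0 hηb1, offDiagGen_eq hηa0 hηa1 α hC,
    diagGenDeriv_eq hηa0 hηa1 α hC, hS, hE, map_mul,
    Complex.conj_ofReal, conj_exp_I_mul]
  rw [heraldedValue, Real.sqrt_mul hts]
  simp only [Complex.ofReal_mul, Complex.ofReal_add, Complex.ofReal_sub, Complex.ofReal_div,
    Complex.ofReal_pow, Complex.ofReal_inv, Complex.ofReal_exp, Complex.ofReal_neg,
    Complex.ofReal_one, Complex.ofReal_ofNat, hJ] at hα hβ hD ⊢
  rw [← hα, ← hβ]
  have hrt := ofReal_sqrt_mul_self (x := 1 - rt) (by linarith)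
  have ht := ofReal_sqrt_mul_self hts
  have ht2 := ofReal_sqrt_mul_self (x := 1 - ts) (by linarith)
  have hp := exp_I_mul_mul_exp_neg φs
  have hexp : Complex.exp (-((1 - rt * (Real.tanh g : ℂ) ^ 2) * ηa * (α * conj α) /
        (1 - rt * (Real.tanh g : ℂ) ^ 2 * (1 - ηa)))) =
      Complex.exp (-(ηa * (α * conj α) * (1 - rt * (Real.tanh g : ℂ) ^ 2)) /
        (1 - (1 - ηa) * (rt * (Real.tanh g : ℂ) ^ 2))) := by
    congr 1
    rw [neg_div]
    congr 2 <;> ring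
  rw [hexp, show 1 - rt * (Real.tanh g : ℂ) ^ 2 * (1 - ηa) =
    1 - (1 - ηa) * (rt * (Real.tanh g : ℂ) ^ 2) by ring]
  rw [Complex.ofReal_sub, Complex.ofReal_one] at hrt ht2
  have hI := mul_inv_cancel₀ hD
  have hpt : Complex.exp (Complex.I * φs) * Real.sqrt (1 - ts) *
      (Complex.exp (-(Complex.I * φs)) * Real.sqrt (1 - ts)) = 1 - (ts : ℂ) := by
    linear_combination Real.sqrt (1 - ts) * Real.sqrt (1 - ts) * hp + ht2
  rw [hpt, ht]
  simp only [div_eq_mul_inv, ← inv_pow]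
  generalize (1 - (1 - (ηa : ℂ)) * (rt * (Real.tanh g : ℂ) ^ 2))⁻¹ = I at hI ⊢
  generalize Complex.exp (-(ηa * (α * conj α) * (1 - rt * (Real.tanh g : ℂ) ^ 2)) * I) = S
  generalize Complex.exp (-(ηb * (β * conj β))) = E
  generalize (∫ ω, conj (f ω) * h ω) = V
  generalize (Real.cosh g : ℂ)⁻¹ = s
  -- `hrt` joins the factors `√(1 - rt)` of the two lines in the interference terms. `hI` merges the
  -- two contributions to `ts`, through `D + C (1 - ηa) = 1`.
  linear_combination 1 / 2 * s ^ 2 * Real.tanh g * S * I ^ 2 * ηa * ηb * Real.sqrt ts *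
      Real.sqrt (1 - ts) * E *
      (Complex.exp (Complex.I * φc) * Complex.exp (-(Complex.I * φs)) * (V * α * β) +
        Complex.exp (-(Complex.I * φc)) * Complex.exp (Complex.I * φs) *
          (conj V * conj α * conj β)) * hrt
    - 1 / 2 * s ^ 2 * (1 - rt) * S * E * I * ts * hI

/-! ### Bob's sources -/

lemma ketbra_sppe (ts φs : ℝ) : ketbra (sppe ts φs) =
    splitState (Complex.exp (Complex.I * φs) * Real.sqrt (1 - ts)) (Real.sqrt ts) onePhoton := by
  have e : ∀ i : ℕ × ℕ, sppe ts φs i = if i.1 + i.2 = 1 then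
      splitAmp (Complex.exp (Complex.I * φs) * Real.sqrt (1 - ts)) (Real.sqrt ts) i.1 i.2
      else 0 := by
    rintro ⟨m, n⟩
    unfold sppe
    split
    · rename_i h
      obtain ⟨rfl, rfl⟩ := Prod.mk.inj h
      simp [splitAmp_zero_left]
    · rename_i h
      obtain ⟨rfl, rfl⟩ := Prod.mk.inj h
      simp [splitAmp_zero_right]
    · rename_i h1 h2
      rw [if_neg]
      intro h
      have : (m = 0 ∧ n = 1) ∨ (m = 1 ∧ n = 0) := by simp only at h; omega
      rcases this with ⟨rfl, rfl⟩ | ⟨rfl, rfl⟩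
      · exact h1 rfl
      · exact h2 rfl
  ext i j
  rw [ketbra, e, e, splitState, onePhoton]
  by_cases hi : i.1 + i.2 = 1 <;> by_cases hj : j.1 + j.2 = 1
  · simp [hi, hj]
  · simp [hi, hj, Ne.symm hj]
  · simp [hi, hj]
  · simp [hi, hj]

lemma opMul_beamSplitter_source (ts φs : ℝ) (P : ℕ → ℂ) :
    opMul (opMul (beamSplitter ts φs) (ketbra vac ⊗ₖ Matrix.diagonal P)) (beamSplitter ts φs)ᴴ =
      splitState (Complex.exp (Complex.I * φs) * Real.sqrt (1 - ts)) (Real.sqrt ts) P := by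
  have hin : ∀ i k : ℕ × ℕ, opMul (beamSplitter ts φs) (ketbra vac ⊗ₖ Matrix.diagonal P) i k =
      if k.1 = 0 then beamSplitter ts φs i k * P k.2 else 0 := by
    rintro i ⟨k₁, k₂⟩
    rw [opMul, tsum_eq_single (k₁, k₂)]
    · by_cases hk : k₁ = 0 <;> simp [ketbra, vac, hk]
    · rintro ⟨l₁, l₂⟩ hl
      by_cases h2 : l₂ = k₂
      · by_cases h1 : l₁ = 0
        · have h3 : k₁ ≠ 0 := fun h3 => hl (by rw [h1, h2, h3])
          simp [ketbra, vac, h3]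
        · simp [ketbra, vac, h1]
      · simp [Matrix.diagonal_apply_ne P h2]
  ext ⟨i₁, i₂⟩ ⟨j₁, j₂⟩
  rw [opMul, tsum_eq_single (0, i₁ + i₂)]
  · rw [hin, if_pos rfl, Matrix.conjTranspose_apply, beamSplitter_right, splitState]
    dsimp only
    split_ifs with h
    · rw [h, beamSplitter_right, RCLike.star_def]
      ring
    · rw [beamSplitter_eq_zero (o := (j₁, j₂)) (by simpa using Ne.symm h), star_zero, mul_zero]
  · rintro ⟨k₁, k₂⟩ hk
    rw [hin]
    split_ifs with h
    · simp only at h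
      subst h
      have : i₁ + i₂ ≠ 0 + k₂ := fun h => hk (by rw [h, zero_add])
      rw [beamSplitter_eq_zero (o := (i₁, i₂)) this, zero_mul, zero_mul]
    · rw [zero_mul]

/-- The photon-number distribution of the heralded source in units of its one-photon weight;
`x` is the squared hyperbolic tangent of the gain. -/
noncomputable def heraldedWeight (ηs x : ℝ) (n : ℕ) : ℝ := x ^ (n - 1) * (1 - (1 - ηs) ^ n) / ηs

lemma ptraceFst_click (gb ηs : ℝ) :
    ptraceFst (opMul (click ηs ⊗ₖ (1 : Matrix ℕ ℕ ℂ)) (ketbra (tmsv gb))) =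
      Matrix.diagonal fun n =>
        (((1 - (1 - ηs) ^ n) * (Real.tanh gb ^ n / Real.cosh gb) ^ 2 : ℝ) : ℂ) := by
  have hin : ∀ i j : ℕ × ℕ, opMul (click ηs ⊗ₖ (1 : Matrix ℕ ℕ ℂ)) (ketbra (tmsv gb)) i j =
      (1 - (1 - (ηs : ℂ)) ^ i.1) * (tmsv gb i * conj (tmsv gb j)) := by
    rintro ⟨i₁, i₂⟩ j
    rw [opMul, tsum_eq_single (i₁, i₂)]
    · simp [click, noClick, ketbra]
    · rintro ⟨k₁, k₂⟩ hk
      by_cases h2 : i₂ = k₂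
      · have h1 : i₁ ≠ k₁ := fun h1 => hk (by rw [h1, h2])
        simp [click, noClick, h1]
      · simp [h2]
  ext n n'
  rw [ptraceFst, tsum_eq_single n]
  · rw [hin]
    by_cases h : n = n'
    · subst h
      have e : tmsv gb (n, n) = ((Real.tanh gb ^ n / Real.cosh gb : ℝ) : ℂ) := if_pos rfl
      rw [e, Complex.conj_ofReal, Matrix.diagonal_apply_eq]
      push_cast
      ring
    · simp [tmsv, h]
  · intro k hk
    rw [hin]
    simp [tmsv, hk]

lemma opTrace_diagonal (P : ℕ → ℂ) : opTrace (Matrix.diagonal P) = ∑' n, P n := by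
  simp [opTrace]

lemma one_sub_one_sub_pow_mem {η : ℝ} (h0 : 0 < η) (h1 : η ≤ 1) (n : ℕ) :
    0 ≤ 1 - (1 - η) ^ n ∧ 1 - (1 - η) ^ n ≤ 1 := by
  have e1 : (0 : ℝ) ≤ (1 - η) ^ n := pow_nonneg (by linarith) n
  have e2 : (1 - η) ^ n ≤ 1 := pow_le_one₀ (by linarith) (by linarith)
  constructor <;> linarith

lemma exists_bobState_eq_smul {gb ηs : ℝ} (ts φs : ℝ) (hg : gb ≠ 0) (h0 : 0 < ηs) (h1 : ηs ≤ 1) :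
    ∃ c : ℂ, c ≠ 0 ∧ bobState gb ηs ts φs =
      c • splitState (Complex.exp (Complex.I * φs) * Real.sqrt (1 - ts)) (Real.sqrt ts)
        fun n => (heraldedWeight ηs (Real.tanh gb ^ 2) n : ℂ) := by
  have hx : 0 < Real.tanh gb ^ 2 := by
    have : Real.tanh gb ≠ 0 := by
      rw [Real.tanh_eq_sinh_div_cosh]
      exact div_ne_zero (fun h => hg (Real.sinh_eq_zero.1 h)) (Real.cosh_pos gb).ne'
    positivity
  have hx1 := tanh_sq_lt_one gb
  have hs : 0 < (Real.cosh gb)⁻¹ ^ 2 := by have := Real.cosh_pos gb; positivity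
  set Q : ℕ → ℝ := fun n => (1 - (1 - ηs) ^ n) * (Real.tanh gb ^ n / Real.cosh gb) ^ 2 with hQ
  have hQ2 : ∀ n, Q n = (1 - (1 - ηs) ^ n) * ((Real.cosh gb)⁻¹ ^ 2 * (Real.tanh gb ^ 2) ^ n) := by
    intro n
    rw [hQ]
    dsimp only
    rw [← pow_mul]
    field_simp
    ring
  have hQ0 : ∀ n, 0 ≤ Q n := fun n => by
    have := (one_sub_one_sub_pow_mem h0 h1 n).1
    positivity
  have hQs : Summable Q := by
    refine Summable.of_nonneg_of_le hQ0 (fun n => ?_)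
      ((summable_geometric_of_lt_one hx.le hx1).mul_left ((Real.cosh gb)⁻¹ ^ 2))
    rw [hQ2]
    exact mul_le_of_le_one_left (by positivity) (one_sub_one_sub_pow_mem h0 h1 n).2
  have hpos : 0 < ∑' n, Q n := hQs.tsum_pos hQ0 1 (by
    rw [hQ2]; simp only [pow_one]; rw [sub_sub_cancel]; positivity)
  -- The one-photon probability `Q 1 / ∑ Q`, nonzero because `gb ≠ 0` and `ηs > 0`.
  refine ⟨(((∑' n, Q n)⁻¹ * ((Real.cosh gb)⁻¹ ^ 2 * Real.tanh gb ^ 2 * ηs) : ℝ) : ℂ), ?_, ?_⟩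
  · exact_mod_cast (by positivity :
      0 < (∑' n, Q n)⁻¹ * ((Real.cosh gb)⁻¹ ^ 2 * Real.tanh gb ^ 2 * ηs)).ne'
  · have hsrc : heraldedSource gb ηs = Matrix.diagonal fun n =>
        (((∑' n, Q n)⁻¹ * ((Real.cosh gb)⁻¹ ^ 2 * Real.tanh gb ^ 2 * ηs) : ℝ) : ℂ) *
          (heraldedWeight ηs (Real.tanh gb ^ 2) n : ℂ) := by
      rw [heraldedSource, ptraceFst_click, normalize, opTrace_diagonal, ← Complex.ofReal_tsum,
        ← Matrix.diagonal_smul]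
      congr 1
      ext n
      rw [Pi.smul_apply, smul_eq_mul, ← Complex.ofReal_inv, ← Complex.ofReal_mul,
        ← Complex.ofReal_mul, Complex.ofReal_inj]
      change (∑' n, Q n)⁻¹ * Q n = _
      rw [mul_assoc, hQ2, heraldedWeight]
      congr 1
      rcases n with _ | n
      · simp
      · rw [Nat.add_sub_cancel, pow_succ (Real.tanh gb ^ 2) n]
        field_simp
    rw [bobState, hsrc, opMul_beamSplitter_source]
    ext i j
    rw [Matrix.smul_apply, splitState, splitState, smul_eq_mul]
    split_ifs
    · ring
    · rw [mul_zero]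

lemma norm_heraldedWeight_le {ηs x : ℝ} (h0 : 0 < ηs) (h1 : ηs ≤ 1) (hx : 0 ≤ x)
    (hx1 : x ≤ 1 / 64) (n : ℕ) :
    ‖(heraldedWeight ηs x n : ℂ)‖ ≤ 64 / ηs * (1 / 64) ^ n := by
  obtain ⟨e1, e2⟩ := one_sub_one_sub_pow_mem h0 h1 n
  rw [Complex.norm_real, heraldedWeight, Real.norm_of_nonneg (by positivity)]
  rcases n with _ | n
  · simp only [pow_zero, sub_self, mul_zero, zero_div]
    positivity
  · rw [Nat.add_sub_cancel, div_mul_eq_mul_div]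
    refine div_le_div_of_nonneg_right ?_ h0.le
    calc x ^ n * (1 - (1 - ηs) ^ (n + 1)) ≤ (1 / 64) ^ n * 1 := by gcongr
      _ = 64 * (1 / 64) ^ (n + 1) := by ring

/-- At `n = 0` the click factor vanishes, so the truncated exponent does no harm; at `n = 1` the
weight is exactly 1; for larger `n` a positive power of `x` remains. -/
lemma tendsto_heraldedWeight {ηs : ℝ} (h0 : 0 < ηs) (n : ℕ) :
    Tendsto (fun x => (heraldedWeight ηs x n : ℂ)) (𝓝 0) (𝓝 (onePhoton n)) := by
  have hcont : Continuous fun x => (heraldedWeight ηs x n : ℂ) := by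
    unfold heraldedWeight
    fun_prop
  convert hcont.tendsto 0 using 2
  rcases n with _ | _ | n
  · simp [onePhoton, heraldedWeight]
  · simp [onePhoton, heraldedWeight, h0.ne']
  · simp [onePhoton, heraldedWeight]

lemma tendsto_tanh_sq : Tendsto (fun g => Real.tanh g ^ 2) (𝓝[≠] 0) (𝓝 0) := by
  have hcont : Continuous fun g => Real.tanh g ^ 2 := by
    simp only [Real.tanh_eq_sinh_div_cosh]
    exact (Real.continuous_sinh.div Real.continuous_cosh fun g => (Real.cosh_pos g).ne').pow 2
  have h := hcont.tendsto 0
  simp only [Real.tanh_zero, ne_eq, OfNat.ofNat_ne_zero, not_false_eq_true, zero_pow] at h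
  exact h.mono_left nhdsWithin_le_nhds

lemma re_mul_of_exp_eq_neg_I {φc φs : ℝ} {z : ℂ}
    (h : Complex.exp (Complex.I * (φc - φs)) = -Complex.I) :
    (Complex.exp (Complex.I * (φc - φs)) * z).re = z.im := by
  rw [h]
  simp

end TwoPhoton

/-! ### The closed forms, their limits and the interference phase -/

theorem mainTheorem4
    (g rt ts rs ηd ηs φs φc : ℝ) (α β : ℂ) (f h : ℝ → ℂ)
    (hrt0 : 0 ≤ rt) (hrt1 : rt < 1)
    (hts : 0 ≤ ts) (hrs : 0 ≤ rs) (htr : ts + rs = 1)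
    (hg : g ≠ 0 ∨ ts ≠ 0)
    (hηd0 : 0 ≤ ηd) (hηd1 : ηd ≤ 1) (hηs0 : 0 < ηs) (hηs1 : ηs ≤ 1)
    (hf : MemLp f 2 volume) (hf1 : ∫ ω, ‖f ω‖ ^ 2 = 1)
    (hh : MemLp h 2 volume) (hh1 : ∫ ω, ‖h ω‖ ^ 2 = 1)
    (v : ℂ) (hv : v = ∫ ω, conj (f ω) * h ω)
    (C : ℝ) (hC : C = rt * Real.tanh g ^ 2)
    (J : ℝ) (hJ : J = (Complex.exp (Complex.I * (φc - φs)) * (v * α * β)).re)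
    (PA PB PAB : ℝ)
    (hPA : PA =
      Real.exp (-((1 - C) * ηd * ‖α‖ ^ 2 / (1 - C * (1 - ηd))))
        * ((1 - C) / (1 - C * (1 - ηd))) ^ 2
        * ((ts * (1 + C * ηd ^ 2 * ‖α‖ ^ 2 / (1 - C * (1 - ηd)))
            + rs * Real.tanh g ^ 2 * (1 - ηd + ηd ^ 2 * ‖α‖ ^ 2 / (1 - C * (1 - ηd))))
          / (ts + rs * Real.tanh g ^ 2)))
    (hPB : PB =
      Real.exp (-(ηd * ‖β‖ ^ 2))
        * ((ts + rs * Real.tanh g ^ 2 * (1 - ηd + ηd ^ 2 * ‖β‖ ^ 2))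
          / (ts + rs * Real.tanh g ^ 2)))
    (hPAB : PAB =
      Real.exp (-((1 - C) * ηd * ‖α‖ ^ 2 / (1 - C * (1 - ηd))) - ηd * ‖β‖ ^ 2) * (1 - C) ^ 2
          / ((ts + rs * Real.tanh g ^ 2) * (1 - C * (1 - ηd)) ^ 2)
        * (ts * (1 + C * ηd ^ 2 * ‖α‖ ^ 2 / (1 - C * (1 - ηd)))
            + rs * Real.tanh g ^ 2 * (1 - ηd + ηd ^ 2 * ‖α‖ ^ 2 / (1 - C * (1 - ηd)))
              * (1 - ηd + ηd ^ 2 * ‖β‖ ^ 2)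
            + 2 * ηd ^ 2 * Real.tanh g * Real.sqrt (ts * rs) * J)) :
    -- values for the ideal single-photon path-entangled source
    (TwoPhoton.probA ηd α
        (TwoPhoton.rhoOut g rt φc f h (TwoPhoton.ketbra (TwoPhoton.sppe ts φs))) = (PA : ℂ) ∧
      TwoPhoton.probB ηd β
        (TwoPhoton.rhoOut g rt φc f h (TwoPhoton.ketbra (TwoPhoton.sppe ts φs))) = (PB : ℂ) ∧
      TwoPhoton.probAB ηd α β
        (TwoPhoton.rhoOut g rt φc f h (TwoPhoton.ketbra (TwoPhoton.sppe ts φs))) = (PAB : ℂ)) ∧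
    -- limits for the heralded source as its gain tends to zero
    (Tendsto (fun gb : ℝ => TwoPhoton.probA ηd α
        (TwoPhoton.rhoOut g rt φc f h (TwoPhoton.bobState gb ηs ts φs))) (𝓝[≠] 0) (𝓝 (PA : ℂ)) ∧
      Tendsto (fun gb : ℝ => TwoPhoton.probB ηd β
        (TwoPhoton.rhoOut g rt φc f h (TwoPhoton.bobState gb ηs ts φs))) (𝓝[≠] 0) (𝓝 (PB : ℂ)) ∧
      Tendsto (fun gb : ℝ => TwoPhoton.probAB ηd α β
        (TwoPhoton.rhoOut g rt φc f h (TwoPhoton.bobState gb ηs ts φs)))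
        (𝓝[≠] 0) (𝓝 (PAB : ℂ))) ∧
    -- the interference term when the relative phase is `-i`, for general and perfect visibility
    (Complex.exp (Complex.I * (φc - φs)) = -Complex.I →
      J = (v * α * β).im ∧ (f = h → J = (α * β).im)) := by
  obtain rfl : rs = 1 - ts := by linarith
  have hts1 : ts ≤ 1 := by linarith
  subst hv hC
  set a : ℂ := Complex.exp (Complex.I * φs) * Real.sqrt (1 - ts)
  set b : ℂ := ((Real.sqrt ts : ℝ) : ℂ)
  have ha : ‖a‖ ≤ 1 := TwoPhoton.norm_bobAmp_le φs hts
  have hb : ‖b‖ ≤ 1 := TwoPhoton.norm_ofReal_sqrt_le_one hts1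
  -- The identity is a measurement of efficiency 0, so norm and marginals are instances of the joint
  -- formula.
  have hone : TwoPhoton.localNoClick 0 0 = 1 := TwoPhoton.localNoClick_zero_left 0
  have hC1 : rt * Real.tanh g ^ 2 < 1 := TwoPhoton.loss_mul_tanh_sq_lt_one g hrt1
  have hC0 : 0 ≤ rt * Real.tanh g ^ 2 := by positivity
  have hval : ∀ {ηa ηb : ℝ} (x y : ℂ), 0 ≤ ηa → ηa ≤ 1 → 0 ≤ ηb → ηb ≤ 1 → _ :=
    fun {ηa ηb} x y p q r s => TwoPhoton.heraldedTrace_onePhoton (g := g) (rt := rt) (ts := ts)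
      (φs := φs) (φc := φc) (ηa := ηa) (ηb := ηb) (α := x) (β := y) hrt0 hrt1 hts hts1 p q r s
      hf1 hh1
  set tr := TwoPhoton.heraldedTrace g rt φc f h (TwoPhoton.splitState a b TwoPhoton.onePhoton)
  have h11 := hval 0 0 le_rfl zero_le_one le_rfl zero_le_one
  have hA := hval α 0 hηd0 hηd1 le_rfl zero_le_one
  have hB := hval 0 β le_rfl zero_le_one hηd0 hηd1
  have hAB := hval α β hηd0 hηd1 hηd0 hηd1
  rw [hone] at h11 hA hB
  -- Heralding has positive weight: if `ts = 0`, Charlie's photon must come from Alice, which needs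
  -- `g ≠ 0`.
  have hw : 0 < ts + (1 - ts) * Real.tanh g ^ 2 := by
    rcases hts.eq_or_lt with e | e
    · have hg0 : g ≠ 0 := hg.resolve_right (by simp [← e])
      have : Real.tanh g ≠ 0 := by
        rw [Real.tanh_eq_sinh_div_cosh]
        exact div_ne_zero (fun h => hg0 (Real.sinh_eq_zero.1 h)) (Real.cosh_pos g).ne'
      rw [← e]
      positivity
    · positivity
  have hcosh := Real.cosh_pos g
  have hD : 0 < 1 - rt * Real.tanh g ^ 2 * (1 - ηd) := by nlinarith
  have hC' : 0 < 1 - rt * Real.tanh g ^ 2 := by linarith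
  have hr' : 0 < 1 - rt := by linarith
  -- Nonvanishing of the limiting norm also makes the inverse continuous in the limit of small gain.
  have hden : tr 1 1 ≠ 0 := by
    rw [h11, Complex.ofReal_ne_zero, TwoPhoton.heraldedValue]
    refine mul_ne_zero (mul_ne_zero (mul_ne_zero (by positivity) hr'.ne') ?_) ?_
    · simpa using hC'.ne'
    · simpa using hw.ne'
  have eA : (tr 1 1)⁻¹ * tr (TwoPhoton.localNoClick ηd α) 1 = (PA : ℂ) := by
    rw [h11, hA, ← Complex.ofReal_inv, ← Complex.ofReal_mul, Complex.ofReal_inj, hPA,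
      TwoPhoton.heraldedValue, TwoPhoton.heraldedValue]
    simp
    field_simp
  have eB : (tr 1 1)⁻¹ * tr 1 (TwoPhoton.localNoClick ηd β) = (PB : ℂ) := by
    rw [h11, hB, ← Complex.ofReal_inv, ← Complex.ofReal_mul, Complex.ofReal_inj, hPB,
      TwoPhoton.heraldedValue, TwoPhoton.heraldedValue]
    simp
    field_simp
    rw [mul_comm rt] at hC'
    exact mul_div_cancel_left₀ _ hC'.ne'
  have eAB : (tr 1 1)⁻¹ * tr (TwoPhoton.localNoClick ηd α) (TwoPhoton.localNoClick ηd β)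
      = (PAB : ℂ) := by
    rw [h11, hAB, ← Complex.ofReal_inv, ← Complex.ofReal_mul, Complex.ofReal_inj, hPAB,
      TwoPhoton.heraldedValue, TwoPhoton.heraldedValue, ← hJ, sub_eq_add_neg (-_), Real.exp_add]
    simp
    field_simp
  have hN1 := TwoPhoton.norm_one_apply_le
  have hNβ := TwoPhoton.norm_localNoClick_le hηd0 hηd1 β
  have hbound : ∀ᶠ y in 𝓝[≠] (0 : ℝ), ∀ n,
      ‖(TwoPhoton.heraldedWeight ηs (Real.tanh y ^ 2) n : ℂ)‖ ≤ 64 / ηs * (1 / 64) ^ n := by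
    filter_upwards [TwoPhoton.tendsto_tanh_sq.eventually
      (eventually_le_nhds (show (0 : ℝ) < 1 / 64 by norm_num))] with y hy
    exact TwoPhoton.norm_heraldedWeight_le hηs0 hηs1 (sq_nonneg _) hy
  have hlim : ∀ n, Tendsto
      (fun y => (TwoPhoton.heraldedWeight ηs (Real.tanh y ^ 2) n : ℂ)) (𝓝[≠] 0)
      (𝓝 (TwoPhoton.onePhoton n)) := fun n =>
    (TwoPhoton.tendsto_heraldedWeight hηs0 n).comp TwoPhoton.tendsto_tanh_sq
  have htend : ∀ (M : Matrix ℕ ℕ ℂ) {N : Matrix ℕ ℕ ℂ}, (∀ m n, ‖N m n‖ ≤ 1) →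
      Tendsto (fun y => (TwoPhoton.heraldedTrace g rt φc f h (TwoPhoton.splitState a b
          fun n => (TwoPhoton.heraldedWeight ηs (Real.tanh y ^ 2) n : ℂ)) 1 1)⁻¹ *
        TwoPhoton.heraldedTrace g rt φc f h (TwoPhoton.splitState a b
          fun n => (TwoPhoton.heraldedWeight ηs (Real.tanh y ^ 2) n : ℂ)) M N) (𝓝[≠] 0)
        (𝓝 ((tr 1 1)⁻¹ * tr M N)) := fun M N hN =>
    ((TwoPhoton.tendsto_heraldedTrace g φc f h hrt0 hrt1.le ha hb hbound hlim 1 hN1).inv₀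
      hden).mul (TwoPhoton.tendsto_heraldedTrace g φc f h hrt0 hrt1.le ha hb hbound hlim M hN)
  have hsource : ∀ᶠ y in 𝓝[≠] (0 : ℝ),
      TwoPhoton.rhoOut g rt φc f h (TwoPhoton.bobState y ηs ts φs) =
        TwoPhoton.rhoOut g rt φc f h (TwoPhoton.splitState a b
          fun n => (TwoPhoton.heraldedWeight ηs (Real.tanh y ^ 2) n : ℂ)) := by
    filter_upwards [self_mem_nhdsWithin] with y hy
    obtain ⟨c, hc, e⟩ := TwoPhoton.exists_bobState_eq_smul ts φs hy hηs0 hηs1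
    rw [e, TwoPhoton.rhoOut_smul hc]
  refine ⟨?_, ⟨?_, ?_, ?_⟩, fun hphase => ?_⟩
  · rw [TwoPhoton.ketbra_sppe,
      TwoPhoton.probA_rhoOut g φc f h hrt0 hrt1 ha hb TwoPhoton.norm_onePhoton_le hηd0 hηd1,
      TwoPhoton.probB_rhoOut g φc f h hrt0 hrt1 ha hb TwoPhoton.norm_onePhoton_le hηd0 hηd1,
      TwoPhoton.probAB_rhoOut g φc f h hrt0 hrt1 ha hb TwoPhoton.norm_onePhoton_le hηd0 hηd1]
    exact ⟨eA, eB, eAB⟩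
  · rw [← eA]
    refine (htend (TwoPhoton.localNoClick ηd α) hN1).congr' ?_
    filter_upwards [hbound, hsource] with y hy e
    rw [e, TwoPhoton.probA_rhoOut g φc f h hrt0 hrt1 ha hb hy hηd0 hηd1]
  · rw [← eB]
    refine (htend 1 hNβ).congr' ?_
    filter_upwards [hbound, hsource] with y hy e
    rw [e, TwoPhoton.probB_rhoOut g φc f h hrt0 hrt1 ha hb hy hηd0 hηd1]
  · rw [← eAB]
    refine (htend (TwoPhoton.localNoClick ηd α) hNβ).congr' ?_
    filter_upwards [hbound, hsource] with y hy e
    rw [e, TwoPhoton.probAB_rhoOut g φc f h hrt0 hrt1 ha hb hy hηd0 hηd1]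
  · rw [hJ, TwoPhoton.re_mul_of_exp_eq_neg_I hphase]
    refine ⟨rfl, ?_⟩
    rintro rfl
    rw [TwoPhoton.integral_conj_mul_self hf1, one_mul]
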